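/- Let \(\Bbbk\) be an algebraically closed field of characteristic \(0\), let \(n \ge 1\), let \(A = \mathrm{M}_n(\Bbbk)\) with the trace form \((a,b) \mapsto \mathrm{tr}(ab)\), and let \(\gamma = \sum_{i,j} E_{ji} \otimes E_{ij} \in A \otimes A\) be the canonical invariant element (equivalently \(\gamma = \sum_p b_p^* \otimes b_p\) for any basis \((b_p)\) of \(A\) and its dual basis \((b_p^*)\) with respect to the trace form). For \(r \in (A \otimes A)[\![x,y]\!][(x-y)^{-1}]\), the \(A\)-CYBE is the equation \[ r^{13}(z_1,z_3)\, r^{12}(z_1,z_2) - r^{12}(z_1,z_2)\, r^{23}(z_2,z_3) + r^{23}(z_2,z_3)\, r^{13}(z_1,z_3) = 0 \] in \((A \otimes A \otimes A)[\![z_1,z_2,z_3]\!]\big[\tfrac{1}{(z_1-z_2)(z_1-z_3)(z_2-z_3)}\big]\), where \((a\otimes b)^{12} = a \otimes b \otimes 1\), \((a \otimes b)^{13} = a \otimes 1 \otimes b\), \((a \otimes b)^{23} = 1 \otimes a \otimes b\), extended coefficient-wise. Two elements \(r_1, r_2\) of \((A \otimes A)[\![x,y]\!][(x-y)^{-1}]\)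 are called equivalent if there are a \(\Bbbk[\![z]\!]\)-algebra automorphism \(\varphi\) of \(A[\![z]\!]\) and \(u \in z\,\Bbbk[\![z]\!]^\times\) with \((\varphi(x) \otimes \varphi(y))\, r_1(u(x),u(y)) = r_2(x,y)\). A series \(r \in (A \otimes A)[\![x,y]\!][(x-y)^{-1}]\) is called * quasi-trigonometric if it is equivalent to \(\dfrac{y\gamma}{x-y} + t(x,y)\) for some polynomial \(t \in (A \otimes A)[x,y]\); * trigonometric if there are an algebra automorphism \(\sigma\) of \(A\) of finite order \(m \ge 1\), a primitive \(m\)-th root of unity \(\varepsilon \in \Bbbk\), and \(t \in L(A,\sigma) \otimes L(A,\sigma)\), where \(L(A,\sigma) = \{a \in A[w,w^{-1}] \mid a(\varepsilon w) = \sigma(a(w))\}\), such that \(r\) is equivalent to \[ \frac{1}{\exp(x-y)-1}\sum_{j=0}^{m-1} \exp\Big(\frac{j(x-y)}{m}\Big)\gamma_j + t\Big(\exp\Big(\frac{x}{m}\Big),\exp\Big(\frac{y}{m}\Big)\Big), \] where \(\gamma_0,\dots,\gamma_{m-1} \in A \otimes A\) are the elements determined by \(\gamma = \sum_{j=0}^{m-1}\gamma_j\)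 and \((\sigma \otimes 1)\gamma_j = \varepsilon^j \gamma_j\). Theorem. There is no trigonometric and no quasi-trigonometric solution \(r \in (A \otimes A)[\![x,y]\!][(x-y)^{-1}]\) of the \(A\)-CYBE. -/

import Mathlib

open scoped TensorProduct

noncomputable section

namespace ACYBE

universe u v

/-! ### Scalars: localised power series rings -/

section Scalars

variable (k : Type u) [Field k]

/-- `k⟦x,y⟧`, with `x = X 0` and `y = X 1`. -/
abbrev Ser2 : Type u := MvPowerSeries (Fin 2) k

/-- `k⟦z₁,z₂,z₃⟧`, with `z₁ = X 0`, `z₂ = X 1`, `z₃ = X 2`. -/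
abbrev Ser3 : Type u := MvPowerSeries (Fin 3) k

/-- The element `x - y`. -/
def diag2 : Ser2 k := MvPowerSeries.X 0 - MvPowerSeries.X 1

/-- The element `(z₁ - z₂)(z₁ - z₃)(z₂ - z₃)`. -/
def diag3 : Ser3 k :=
  (MvPowerSeries.X 0 - MvPowerSeries.X 1) * (MvPowerSeries.X 0 - MvPowerSeries.X 2) *
    (MvPowerSeries.X 1 - MvPowerSeries.X 2)

/-- `k⟦x,y⟧[(x-y)⁻¹]`. -/
abbrev Loc2 : Type u := Localization.Away (diag2 k)

/-- `k⟦z₁,z₂,z₃⟧[((z₁-z₂)(z₁-z₃)(z₂-z₃))⁻¹]`. -/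
abbrev Loc3 : Type u := Localization.Away (diag3 k)

variable {k}

/-- The canonical map `k⟦x,y⟧ → k⟦x,y⟧[(x-y)⁻¹]`. -/
def toLoc2 : Ser2 k →ₐ[k] Loc2 k := IsScalarTower.toAlgHom k (Ser2 k) (Loc2 k)

theorem isUnit_toLoc2 : IsUnit (toLoc2 (diag2 k)) :=
  IsLocalization.Away.algebraMap_isUnit (diag2 k)

/-- The canonical map from `k⟦z₁,z₂,z₃⟧` to its localisation. -/
def toLoc3 : Ser3 k →ₐ[k] Loc3 k := IsScalarTower.toAlgHom k (Ser3 k) (Loc3 k)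

/-- The `k`-algebra homomorphism `k⟦x,y⟧[(x-y)⁻¹] → R` extending `f : k⟦x,y⟧ → R` when `f (x - y)`
is invertible. -/
def liftLoc2 {R : Type u} [CommRing R] [Algebra k R] (f : Ser2 k →ₐ[k] R)
    (hf : IsUnit (f (diag2 k))) : Loc2 k →ₐ[k] R :=
  IsLocalization.liftAlgHom (M := Submonoid.powers (diag2 k)) (f := f) (by
    rintro ⟨_, m, rfl⟩
    simpa using hf.pow m)

theorem liftLoc2_toLoc2 {R : Type u} [CommRing R] [Algebra k R] (f : Ser2 k →ₐ[k] R)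
    (hf : IsUnit (f (diag2 k))) (p : Ser2 k) : liftLoc2 f hf (toLoc2 p) = f p :=
  IsLocalization.lift_eq _ _

/-- `f(x,y) ↦ f(zᵢ,zⱼ)` on power series. -/
def subst3 (i j : Fin 3) : Ser2 k →ₐ[k] Ser3 k :=
  MvPowerSeries.substAlgHom (S := k)
    (a := ![(MvPowerSeries.X i : Ser3 k), MvPowerSeries.X j])
    (MvPowerSeries.hasSubst_of_constantCoeff_zero (by
      intro s; fin_cases s <;> simp))

theorem subst3_diag2 (i j : Fin 3) :
    subst3 i j (diag2 k) = MvPowerSeries.X i - MvPowerSeries.X j := by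
  simp only [subst3, diag2, map_sub, MvPowerSeries.substAlgHom_X]
  simp

theorem isUnit_toLoc3 : IsUnit (toLoc3 (diag3 k)) :=
  IsLocalization.Away.algebraMap_isUnit (diag3 k)

theorem isUnit_subst3 (i j : Fin 3) (hij : i < j) :
    IsUnit ((toLoc3.comp (subst3 i j)) (diag2 k)) := by
  rw [AlgHom.comp_apply, subst3_diag2]
  refine isUnit_of_dvd_unit (map_dvd toLoc3 ?_) isUnit_toLoc3
  have h : (i = 0 ∧ j = 1) ∨ (i = 0 ∧ j = 2) ∨ (i = 1 ∧ j = 2) := by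
    revert i j; decide
  rcases h with ⟨rfl, rfl⟩ | ⟨rfl, rfl⟩ | ⟨rfl, rfl⟩
  · exact Dvd.intro _ (mul_assoc _ _ _).symm
  · exact Dvd.intro_left _ rfl |>.trans (Dvd.intro _ rfl)
  · exact Dvd.intro_left _ rfl

/-- `f(x,y) ↦ f(zᵢ,zⱼ)` for `i < j`, on the localised rings. -/
def scalarIJ (i j : Fin 3) (hij : i < j) : Loc2 k →ₐ[k] Loc3 k :=
  liftLoc2 (toLoc3.comp (subst3 i j)) (isUnit_subst3 i j hij)

end Scalars

/-! ### The classical Yang-Baxter equation with coefficients in `A` -/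

section CYBE

variable (k : Type u) [Field k] (A : Type v) [Ring A] [Algebra k A]

/-- `(A ⊗ A)⟦x,y⟧[(x-y)⁻¹]`, written as `k⟦x,y⟧[(x-y)⁻¹] ⊗ (A ⊗ A)`; the two agree since the
algebras `A` considered here are finite-dimensional. -/
abbrev Tensor2 : Type (max u v) := Loc2 k ⊗[k] (A ⊗[k] A)

/-- `(A ⊗ A ⊗ A)⟦z₁,z₂,z₃⟧[((z₁-z₂)(z₁-z₃)(z₂-z₃))⁻¹]`. -/
abbrev Tensor3 : Type (max u v) := Loc3 k ⊗[k] (A ⊗[k] (A ⊗[k] A))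

/-- `r ↦ r¹²(z₁,z₂)`, with `(a ⊗ b)¹² = a ⊗ b ⊗ 1`. -/
def leg12 : Tensor2 k A →ₐ[k] Tensor3 k A :=
  Algebra.TensorProduct.map (scalarIJ 0 1 (by decide))
    (Algebra.TensorProduct.map (AlgHom.id k A) Algebra.TensorProduct.includeLeft)

/-- `r ↦ r¹³(z₁,z₃)`, with `(a ⊗ b)¹³ = a ⊗ 1 ⊗ b`. -/
def leg13 : Tensor2 k A →ₐ[k] Tensor3 k A :=
  Algebra.TensorProduct.map (scalarIJ 0 2 (by decide))
    (Algebra.TensorProduct.map (AlgHom.id k A) Algebra.TensorProduct.includeRight)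

/-- `r ↦ r²³(z₂,z₃)`, with `(a ⊗ b)²³ = 1 ⊗ a ⊗ b`. -/
def leg23 : Tensor2 k A →ₐ[k] Tensor3 k A :=
  Algebra.TensorProduct.map (scalarIJ 1 2 (by decide)) Algebra.TensorProduct.includeRight

variable {k A}

/-- `CYB(r) = r¹³ r¹² - r¹² r²³ + r²³ r¹³`. -/
def CYB (r : Tensor2 k A) : Tensor3 k A :=
  leg13 k A r * leg12 k A r - leg12 k A r * leg23 k A r + leg23 k A r * leg13 k A r

end CYBE

/-! ### Equivalence -/

section Equivalence

variable {k : Type u} [Field k]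

/-- For `f = ∑ fₙ zⁿ`, the series `(f(x) - f(y)) / (x - y) = ∑ fᵢ₊ⱼ₊₁ xⁱ yʲ`. -/
def divDiff (f : PowerSeries k) : Ser2 k := fun e => PowerSeries.coeff (e 0 + e 1 + 1) f

theorem diag2_mul_divDiff (f : PowerSeries k) :
    diag2 k * divDiff f =
      PowerSeries.subst (MvPowerSeries.X 0 : Ser2 k) f -
        PowerSeries.subst (MvPowerSeries.X 1 : Ser2 k) f := by
  classical
  have hs : ∀ (e : Fin 2 →₀ ℕ) (s : Fin 2), e = Finsupp.single s (e s) ↔ e (1 - s) = 0 := by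
    intro e s
    constructor
    · intro h
      rw [h]
      fin_cases s <;> simp
    · intro h
      ext t
      fin_cases s <;> fin_cases t <;> simp_all
  have hX : ∀ (s : Fin 2) (e : Fin 2 →₀ ℕ),
      MvPowerSeries.coeff e ((MvPowerSeries.X s : Ser2 k) * divDiff f) =
        if 1 ≤ e s then PowerSeries.coeff (e 0 + e 1) f else 0 := by
    intro s e
    rw [MvPowerSeries.X, MvPowerSeries.coeff_monomial_mul]
    simp only [Finsupp.single_le_iff, one_mul]
    split_ifs with h
    · change PowerSeries.coeff ((e - Finsupp.single s 1 : Fin 2 →₀ ℕ) 0 +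
        (e - Finsupp.single s 1 : Fin 2 →₀ ℕ) 1 + 1) f = _
      congr 2
      fin_cases s <;> simp at h ⊢ <;> omega
    · rfl
  ext e
  rw [diag2, sub_mul, map_sub, map_sub, hX, hX, PowerSeries.coeff_subst_single,
    PowerSeries.coeff_subst_single]
  simp only [hs]
  have h1 : (1 : Fin 2) - 0 = 1 := rfl
  have h2 : (1 : Fin 2) - 1 = 0 := rfl
  rw [h1, h2]
  rcases Nat.eq_zero_or_pos (e 0) with h0 | h0 <;> rcases Nat.eq_zero_or_pos (e 1) with h3 | h3
  · simp [h0, h3]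
  · simp [h0, h3.ne', Nat.one_le_iff_ne_zero]
  · simp [h3, h0.ne', Nat.one_le_iff_ne_zero]
  · simp [h3.ne', h0.ne', Nat.one_le_iff_ne_zero]

/-- `f(x,y) ↦ f(u(x),u(y))` on power series, for `u = z v`. -/
def substU (v : (PowerSeries k)ˣ) : Ser2 k →ₐ[k] Ser2 k :=
  MvPowerSeries.substAlgHom (S := k)
    (a := fun i : Fin 2 =>
      PowerSeries.subst (MvPowerSeries.X i : Ser2 k) (PowerSeries.X * (v : PowerSeries k)))
    (MvPowerSeries.hasSubst_of_constantCoeff_zero (fun i =>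
      PowerSeries.constantCoeff_subst_eq_zero (by simp) _ (by simp)))

theorem isUnit_substU (v : (PowerSeries k)ˣ) :
    IsUnit ((toLoc2.comp (substU v)) (diag2 k)) := by
  have h : substU v (diag2 k) =
      diag2 k * divDiff (PowerSeries.X * (v : PowerSeries k)) := by
    rw [diag2_mul_divDiff]
    simp only [substU, diag2, map_sub, MvPowerSeries.substAlgHom_X]
  rw [AlgHom.comp_apply, h, map_mul]
  refine (isUnit_toLoc2).mul (IsUnit.map toLoc2 ?_)
  rw [MvPowerSeries.isUnit_iff_constantCoeff]
  have h0 : MvPowerSeries.constantCoeff (divDiff (PowerSeries.X * (v : PowerSeries k))) =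
      PowerSeries.constantCoeff (v : PowerSeries k) := by
    change PowerSeries.coeff (0 + 0 + 1) (PowerSeries.X * (v : PowerSeries k)) = _
    rw [PowerSeries.coeff_succ_X_mul]
    simp
  rw [h0]
  exact v.isUnit.map _

/-- `f(x,y) ↦ f(u(x),u(y))` on `k⟦x,y⟧[(x-y)⁻¹]`, for `u = z v` with `v ∈ k⟦z⟧ˣ`. -/
def scalarU (v : (PowerSeries k)ˣ) : Loc2 k →ₐ[k] Loc2 k :=
  liftLoc2 (toLoc2.comp (substU v)) (isUnit_substU v)

/-- `f(z) ↦ f(x)` (for `i = 0`) and `f(z) ↦ f(y)` (for `i = 1`). -/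
def atVar (i : Fin 2) : PowerSeries k →ₐ[k] Loc2 k :=
  toLoc2.comp (PowerSeries.substAlgHom (S := k) (PowerSeries.HasSubst.X i))

variable (k) (A : Type v) [Ring A] [Algebra k A]

/-- `A⟦z⟧`, written as `k⟦z⟧ ⊗ A` (with `A` finite-dimensional). -/
abbrev PowA : Type (max u v) := PowerSeries k ⊗[k] A

variable {k A}

/-- `a ↦ a ⊗ 1` (for `i = 0`) and `a ↦ 1 ⊗ a` (for `i = 1`). -/
def incl (i : Fin 2) : A →ₐ[k] A ⊗[k] A :=
  if i = 0 then Algebra.TensorProduct.includeLeft else Algebra.TensorProduct.includeRight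

/-- `A → (A ⊗ A)⟦x,y⟧[(x-y)⁻¹]`: for `i = 0`, `a ↦ φ(x)(a) ⊗ 1`; for `i = 1`,
`a ↦ 1 ⊗ φ(y)(a)`. -/
def autAt (φ : PowA k A ≃ₐ[PowerSeries k] PowA k A) (i : Fin 2) : A →ₐ[k] Tensor2 k A :=
  (Algebra.TensorProduct.map (atVar i) (incl i)).comp
    ((φ.toAlgHom.restrictScalars k).comp Algebra.TensorProduct.includeRight)

/-- `φ(x) ⊗ φ(y)`, i.e. `s(x,y) (a ⊗ b) ↦ s(x,y) (φ(x)(a) ⊗ φ(y)(b))`. -/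
def autTensor (φ : PowA k A ≃ₐ[PowerSeries k] PowA k A) : Tensor2 k A →ₗ[k] Tensor2 k A :=
  LinearMap.mul' k (Tensor2 k A) ∘ₗ
    TensorProduct.map
      (Algebra.TensorProduct.includeLeft : Loc2 k →ₐ[k] Tensor2 k A).toLinearMap
      (LinearMap.mul' k (Tensor2 k A) ∘ₗ
        TensorProduct.map (autAt φ 0).toLinearMap (autAt φ 1).toLinearMap)

/-- `r₁ ∼ r₂`: there are `φ ∈ Aut(A⟦z⟧)`, linear over `k⟦z⟧`, and `u ∈ z k⟦z⟧ˣ` such that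
`(φ(x) ⊗ φ(y)) r₁(u(x),u(y)) = r₂(x,y)`. -/
def Equivalent (r₁ r₂ : Tensor2 k A) : Prop :=
  ∃ (φ : PowA k A ≃ₐ[PowerSeries k] PowA k A) (v : (PowerSeries k)ˣ),
    autTensor φ
      (Algebra.TensorProduct.map (scalarU v) (AlgHom.id k (A ⊗[k] A)) r₁) = r₂

end Equivalence

/-! ### Quasi-trigonometric and trigonometric series -/

section Quasi

variable (k : Type u) [Field k] (A : Type v) [Ring A] [Algebra k A]

/-- `(A ⊗ A)[x,y] → (A ⊗ A)⟦x,y⟧[(x-y)⁻¹]`. -/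
def polyTensor : MvPolynomial (Fin 2) k ⊗[k] (A ⊗[k] A) →ₐ[k] Tensor2 k A :=
  Algebra.TensorProduct.map
    (toLoc2.comp (MvPolynomial.coeToMvPowerSeries.algHom k)) (AlgHom.id k (A ⊗[k] A))

variable {k A}

/-- `y γ / (x - y) + t(x,y)`. -/
def quasiTrigForm (γ : A ⊗[k] A) (t : MvPolynomial (Fin 2) k ⊗[k] (A ⊗[k] A)) : Tensor2 k A :=
  (toLoc2 (MvPowerSeries.X 1) * IsLocalization.Away.invSelf (diag2 k)) ⊗ₜ[k] γ + polyTensor k A t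

/-- `r` is equivalent to `y γ / (x - y) + t(x,y)` for a polynomial `t ∈ (A ⊗ A)[x,y]`. -/
def IsQuasiTrigonometric (γ : A ⊗[k] A) (r : Tensor2 k A) : Prop :=
  ∃ t : MvPolynomial (Fin 2) k ⊗[k] (A ⊗[k] A), Equivalent r (quasiTrigForm γ t)

end Quasi

section Trig

variable {k : Type u} [Field k]

section Loop

variable {A : Type v} [Ring A] [Algebra k A]

/-- The twisted loop algebra `L(A,σ) = {a ∈ A[w,w⁻¹] ∣ a(ε w) = σ(a(w))}`, as a subspace of the
Laurent polynomials; for `a = ∑ aⱼ wʲ` the condition says `εʲ aⱼ = σ(aⱼ)` for all `j ∈ ℤ`. -/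
def loopAlgebra (σ : A ≃ₐ[k] A) (ε : k) : Submodule k (LaurentPolynomial A) where
  carrier := {a | ∀ j : ℤ, ε ^ j • a.coeff j = σ (a.coeff j)}
  zero_mem' := by intro j; simp
  add_mem' := by
    intro a b ha hb j
    have h1 := ha j
    have h2 := hb j
    simp only [AddMonoidAlgebra.coeff_add, Finsupp.add_apply, smul_add, map_add, h1, h2]
  smul_mem' := by
    intro c a ha j
    have h1 := ha j
    simp only [AddMonoidAlgebra.coeff_smul, Finsupp.smul_apply, map_smul, ← h1]
    rw [smul_comm]

end Loop

variable [CharZero k]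

/-- `exp(p)` for a power series `p` without constant term. -/
def expSer (p : Ser2 k) : Ser2 k := PowerSeries.subst p (PowerSeries.exp k)

/-- The denominator `exp(x - y) - 1`. -/
def expDiag : Ser2 k := expSer (diag2 k) - 1

/-- `exp(x - y) - 1` is invertible in `k⟦x,y⟧[(x-y)⁻¹]`. -/
theorem isUnit_expDiag : IsUnit (toLoc2 (expDiag : Ser2 k)) := by
  have hd : PowerSeries.HasSubst (diag2 k) :=
    PowerSeries.HasSubst.of_constantCoeff_zero (by simp [diag2])
  obtain ⟨g, hg⟩ : (PowerSeries.X : PowerSeries k) ∣ PowerSeries.exp k - 1 := by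
    rw [PowerSeries.X_dvd_iff]
    simp
  have hu : IsUnit g := by
    rw [PowerSeries.isUnit_iff_constantCoeff]
    have h := congrArg (PowerSeries.coeff 1) hg
    rw [show (1 : ℕ) = 0 + 1 from rfl, PowerSeries.coeff_succ_X_mul,
      PowerSeries.coeff_zero_eq_constantCoeff_apply] at h
    rw [← h]
    simp [PowerSeries.coeff_exp, PowerSeries.coeff_one]
  have h : (expDiag : Ser2 k) = diag2 k * PowerSeries.substAlgHom hd g := by
    have h1 := congrArg (PowerSeries.substAlgHom hd) hg
    rw [map_sub, map_mul, map_one, PowerSeries.substAlgHom_X, PowerSeries.coe_substAlgHom] at h1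
    rw [expDiag, expSer, h1, PowerSeries.coe_substAlgHom]
  rw [h, map_mul]
  exact isUnit_toLoc2.mul ((hu.map _).map _)

variable {A : Type v} [Ring A] [Algebra k A]

/-- `A[w,w⁻¹] → (A ⊗ A)⟦x,y⟧[(x-y)⁻¹]`: for `i = 0`, `a(w) ↦ a(exp(x/m)) ⊗ 1`; for `i = 1`,
`a(w) ↦ 1 ⊗ a(exp(y/m))`. Here `exp(x/m)ʲ` is written as `exp((j/m) x)`. -/
def expEval (m : ℕ) (i : Fin 2) : LaurentPolynomial A →ₗ[k] Tensor2 k A :=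
  (Finsupp.lsum k fun j : ℤ =>
      (TensorProduct.mk k (Loc2 k) (A ⊗[k] A)
        (toLoc2 (expSer (((j : k) / (m : k)) • MvPowerSeries.X i)))) ∘ₗ
        (incl (k := k) (A := A) i).toLinearMap) ∘ₗ
    (AddMonoidAlgebra.coeffLinearEquiv k).toLinearMap

/-- `t(v,w) ↦ t(exp(x/m), exp(y/m))` for `t ∈ L(A,σ) ⊗ L(A,σ)`. -/
def expEval2 (m : ℕ) (σ : A ≃ₐ[k] A) (ε : k) :
    loopAlgebra σ ε ⊗[k] loopAlgebra σ ε →ₗ[k] Tensor2 k A :=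
  LinearMap.mul' k (Tensor2 k A) ∘ₗ
    TensorProduct.map (expEval m 0 ∘ₗ (loopAlgebra σ ε).subtype)
      (expEval m 1 ∘ₗ (loopAlgebra σ ε).subtype)

/-- `(exp(x-y) - 1)⁻¹ ∑_{j<m} exp(j(x-y)/m) γⱼ + t(exp(x/m), exp(y/m))`. -/
def trigForm (m : ℕ) (σ : A ≃ₐ[k] A) (ε : k) (γs : ℕ → A ⊗[k] A)
    (t : loopAlgebra σ ε ⊗[k] loopAlgebra σ ε) : Tensor2 k A :=
  ∑ j ∈ Finset.range m,
      (Ring.inverse (toLoc2 (expDiag : Ser2 k)) *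
        toLoc2 (expSer (((j : k) / (m : k)) • diag2 k))) ⊗ₜ[k] γs j +
    expEval2 m σ ε t

/-- `r` is equivalent to
`(exp(x-y) - 1)⁻¹ ∑_{j<m} exp(j(x-y)/m) γⱼ + t(exp(x/m), exp(y/m))`, where `σ` is an algebra
automorphism of `A` of finite order `m`, `ε` is a primitive `m`-th root of unity,
`γ = ∑_{j<m} γⱼ` with `(σ ⊗ 1) γⱼ = εʲ γⱼ`, and `t ∈ L(A,σ) ⊗ L(A,σ)`. -/
def IsTrigonometric (γ : A ⊗[k] A) (r : Tensor2 k A) : Prop :=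
  ∃ (m : ℕ) (σ : A ≃ₐ[k] A) (ε : k) (γs : ℕ → A ⊗[k] A)
    (t : loopAlgebra σ ε ⊗[k] loopAlgebra σ ε),
    0 < m ∧ orderOf σ = m ∧ IsPrimitiveRoot ε m ∧
    (∑ j ∈ Finset.range m, γs j = γ) ∧
    (∀ j < m, TensorProduct.map σ.toLinearMap LinearMap.id (γs j) = ε ^ j • γs j) ∧
    Equivalent r (trigForm m σ ε γs t)

end Trig

/-! ### The matrix algebra with its trace form -/

section Matrices

variable (k : Type u) [Field k] (n : ℕ)

/-- The canonical invariant element `γ = ∑ bᵢ* ⊗ bᵢ` of `M_n(k)` with the form `tr(ab)`, for the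
basis of matrix units: the dual basis element of `E_{ij}` is `E_{ji}`. -/
def casimir : Matrix (Fin n) (Fin n) k ⊗[k] Matrix (Fin n) (Fin n) k :=
  ∑ i : Fin n, ∑ j : Fin n, Matrix.single j i (1 : k) ⊗ₜ[k] Matrix.single i j (1 : k)

/-- `γ = ∑ bᵢ* ⊗ bᵢ` for every pair of bases that are dual with respect to `tr(ab)`. -/
theorem casimir_eq {ι : Type*} [Fintype ι] [DecidableEq ι]
    (b b' : Module.Basis ι k (Matrix (Fin n) (Fin n) k))
    (h : ∀ p q, (b' p * b q).trace = if p = q then 1 else 0) :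
    casimir k n = ∑ p, b' p ⊗ₜ[k] b p := by
  have hx : ∀ x : Matrix (Fin n) (Fin n) k, x = ∑ p, (b' p * x).trace • b p := by
    intro x
    have h2 : ∀ p, (b' p * x).trace = b.repr x p := by
      intro p
      calc (b' p * x).trace = (b' p * ∑ q, b.repr x q • b q).trace := by rw [b.sum_repr x]
        _ = b.repr x p := by
          simp only [Finset.mul_sum, Matrix.trace_sum, Matrix.mul_smul, Matrix.trace_smul, h]
          simp
    simp only [h2]
    exact (b.sum_repr x).symm
  have hy : ∀ y : Matrix (Fin n) (Fin n) k,
      ∑ i : Fin n, ∑ j : Fin n, (y * Matrix.single i j (1 : k)).trace •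
        Matrix.single j i (1 : k) = y := by
    intro y
    simp only [Matrix.trace_mul_single]
    conv_rhs => rw [Matrix.matrix_eq_sum_single y, Finset.sum_comm]
    simp
  calc casimir k n
      = ∑ i : Fin n, ∑ j : Fin n, Matrix.single j i (1 : k) ⊗ₜ[k]
          ∑ p, (b' p * Matrix.single i j (1 : k)).trace • b p := by
        unfold casimir
        refine Finset.sum_congr rfl fun i _ => Finset.sum_congr rfl fun j _ => ?_
        rw [← hx]
    _ = ∑ p, (∑ i : Fin n, ∑ j : Fin n, (b' p * Matrix.single i j (1 : k)).trace •
          Matrix.single j i (1 : k)) ⊗ₜ[k] b p := by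
        simp only [TensorProduct.tmul_sum, TensorProduct.sum_tmul, TensorProduct.tmul_smul,
          TensorProduct.smul_tmul']
        rw [Finset.sum_comm_cycle]
    _ = ∑ p, b' p ⊗ₜ[k] b p := by simp only [hy]

end Matrices

end ACYBE

end

/-! Equivalence acts on both sides of the CYBE by algebra homomorphisms, so only the two normal
forms matter. In the multiplicative variables `x`, `y` (the exponentials `exp(x/m)`, `exp(y/m)` in
the trigonometric case, the coordinates themselves with `m = 1` in the quasi-trigonometric one) each
normal form is `∑_{j<m} (x/y)^j γ_j / ((x/y)^m - 1)` plus a Laurent polynomial. Independent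
exponentials are algebraically independent, and polynomials embed in power series, so the CYBE
becomes an identity of Laurent polynomials that may be evaluated at any units (`LaurentCYBE`).

Let `f_c^α` be the matrix in the first tensor factor of `r(x,c)` at the entry `α` of the second
factor. The CYBE at `(x,c,c')` says that `f_{c'}^β f_c^α` is a combination of the `f_c` and the
`f_{c'}` with coefficients free of `x` (`slice_mul_slice`). Hence products over distinct points
`c_i` stay in the span of the factors: their poles at `x = 0` and `x = ∞` remain bounded. Let `τ` be
the constant term of the trace at `∞` minus that at `0`. Automorphisms of `M_n` preserve the trace,
so tracing the first factor leaves only `δ_{ab} / ((x/c)^m - 1)` plus a Laurent polynomial;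
therefore `τ(f_c^α) = δ_{α₁α₂}`, and the multiplication rule forces `τ = 0` on products of at least
two factors.

Boundedness and the vanishing of `τ` survive letting all `c_i` tend to `1`. They then hold for the
powers of one matrix `f`, expanded at `∞` and at `0`. Bounded powers make each expansion preserve a
lattice over `k⟦s⟧`, so the constant terms of the traces of its powers are the traces of the powers
of a matrix over `k` (`exists_matrix_trace_pow_eq`). The two matrices over `k` have equal traces in
all powers from the second on, hence equal traces (`trace_eq_of_trace_pow_eq`), whereas `τ(f) = 1`
for a diagonal index. -/

noncomputable section

namespace ACYBE

universe u v

/-! ### Invariance of the Yang-Baxter equation under equivalence. -/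

section Naturality

variable {k : Type u} [Field k]

/-- `f(z₁,z₂,z₃) ↦ f(u(z₁),u(z₂),u(z₃))` on power series, for `u = z v`. -/
def substU3 (v : (PowerSeries k)ˣ) : Ser3 k →ₐ[k] Ser3 k :=
  MvPowerSeries.substAlgHom (S := k)
    (a := fun i : Fin 3 =>
      PowerSeries.subst (MvPowerSeries.X i : Ser3 k) (PowerSeries.X * (v : PowerSeries k)))
    (MvPowerSeries.hasSubst_of_constantCoeff_zero (fun i =>
      PowerSeries.constantCoeff_subst_eq_zero (by simp) _ (by simp)))

theorem hasSubst_pair (i j : Fin 3) :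
    MvPowerSeries.HasSubst ![(MvPowerSeries.X i : Ser3 k), MvPowerSeries.X j] :=
  MvPowerSeries.hasSubst_of_constantCoeff_zero (by intro s; fin_cases s <;> simp)

theorem subst3_X (i j : Fin 3) (s : Fin 2) :
    subst3 i j (MvPowerSeries.X s : Ser2 k) = MvPowerSeries.X (![i, j] s) := by
  rw [subst3, MvPowerSeries.substAlgHom_X]
  fin_cases s <;> rfl

theorem subst3_powerSeries_subst (i j : Fin 3) (p : Ser2 k) (hp : PowerSeries.HasSubst p)
    (f : PowerSeries k) :
    subst3 i j (PowerSeries.subst p f) = PowerSeries.subst (subst3 i j p) f := by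
  rw [subst3, MvPowerSeries.coe_substAlgHom]
  exact MvPowerSeries.subst_comp_subst_apply hp.const (hasSubst_pair i j) f

/-- Both composites send `x` to `u(zᵢ)` and `y` to `u(zⱼ)`; composition of substitutions does the
rest. -/
theorem substU3_comp_subst3 (v : (PowerSeries k)ˣ) (i j : Fin 3) :
    (substU3 v).comp (subst3 i j) = (subst3 i j).comp (substU v) := by
  apply AlgHom.ext
  intro f
  have h1 : ∀ s : Fin 2, subst3 i j (PowerSeries.subst (MvPowerSeries.X s : Ser2 k)
      (PowerSeries.X * (v : PowerSeries k))) =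
      PowerSeries.subst (MvPowerSeries.X (![i, j] s) : Ser3 k)
        (PowerSeries.X * (v : PowerSeries k)) := by
    intro s
    rw [subst3_powerSeries_subst _ _ _ (PowerSeries.HasSubst.X s), subst3_X]
  have hU : MvPowerSeries.HasSubst (fun i : Fin 3 =>
      PowerSeries.subst (MvPowerSeries.X i : Ser3 k) (PowerSeries.X * (v : PowerSeries k))) :=
    MvPowerSeries.hasSubst_of_constantCoeff_zero (fun i =>
      PowerSeries.constantCoeff_subst_eq_zero (by simp) _ (by simp))
  have hU2 : MvPowerSeries.HasSubst (fun i : Fin 2 =>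
      PowerSeries.subst (MvPowerSeries.X i : Ser2 k) (PowerSeries.X * (v : PowerSeries k))) :=
    MvPowerSeries.hasSubst_of_constantCoeff_zero (fun i =>
      PowerSeries.constantCoeff_subst_eq_zero (by simp) _ (by simp))
  simp only [AlgHom.comp_apply]
  simp only [subst3, MvPowerSeries.coe_substAlgHom] at h1
  simp only [substU3, subst3, substU, MvPowerSeries.coe_substAlgHom]
  rw [MvPowerSeries.subst_comp_subst_apply (hasSubst_pair i j) hU,
    MvPowerSeries.subst_comp_subst_apply hU2 (hasSubst_pair i j)]
  congr 1
  funext s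
  rw [h1]
  have : (![(MvPowerSeries.X i : Ser3 k), MvPowerSeries.X j] s) = MvPowerSeries.X (![i, j] s) := by
    fin_cases s <;> rfl
  rw [this, MvPowerSeries.subst_X hU]

theorem scalarIJ_toLoc2 (i j : Fin 3) (hij : i < j) (p : Ser2 k) :
    scalarIJ i j hij (toLoc2 p) = toLoc3 (subst3 i j p) :=
  liftLoc2_toLoc2 _ _ p

theorem scalarU_toLoc2 (w : (PowerSeries k)ˣ) (p : Ser2 k) :
    scalarU w (toLoc2 p) = toLoc2 (substU w p) :=
  liftLoc2_toLoc2 _ _ p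

theorem Loc2_algHom_ext {R : Type u} [CommRing R] [Algebra k R] {f g : Loc2 k →ₐ[k] R}
    (h : ∀ p, f (toLoc2 p) = g (toLoc2 p)) : f = g := by
  have : f.toRingHom = g.toRingHom :=
    IsLocalization.ringHom_ext (Submonoid.powers (diag2 k)) (RingHom.ext h)
  exact AlgHom.ext fun x => congrArg (fun F : Loc2 k →+* R => F x) this

/-- Each factor `u(zᵢ) - u(zⱼ)` is the image under `scalarIJ` of `u(x) - u(y)`, already known to be
a unit in two variables. -/
theorem isUnit_substU3 (w : (PowerSeries k)ˣ) :
    IsUnit ((toLoc3.comp (substU3 w)) (diag3 k)) := by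
  have h : ∀ i j : Fin 3, i < j →
      IsUnit (toLoc3 (substU3 w (MvPowerSeries.X i - MvPowerSeries.X j : Ser3 k))) := by
    intro i j hij
    rw [← subst3_diag2, ← AlgHom.comp_apply (substU3 w), substU3_comp_subst3, AlgHom.comp_apply,
      ← scalarIJ_toLoc2 i j hij]
    exact (isUnit_substU w).map _
  have h3 : diag3 k = (MvPowerSeries.X 0 - MvPowerSeries.X 1) *
      (MvPowerSeries.X 0 - MvPowerSeries.X 2) * (MvPowerSeries.X 1 - MvPowerSeries.X 2) := rfl
  have h4 : (toLoc3.comp (substU3 w)) (diag3 k) =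
      toLoc3 (substU3 w (MvPowerSeries.X 0 - MvPowerSeries.X 1)) *
        toLoc3 (substU3 w (MvPowerSeries.X 0 - MvPowerSeries.X 2)) *
        toLoc3 (substU3 w (MvPowerSeries.X 1 - MvPowerSeries.X 2)) := by
    simp only [← map_mul, ← h3, AlgHom.comp_apply]
  rw [h4]
  exact ((h 0 1 (by decide)).mul (h 0 2 (by decide))).mul (h 1 2 (by decide))

/-- `f(z₁,z₂,z₃) ↦ f(u(z₁),u(z₂),u(z₃))` on the localised ring, for `u = z v`. -/
def scalarU3 (w : (PowerSeries k)ˣ) : Loc3 k →ₐ[k] Loc3 k :=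
  IsLocalization.liftAlgHom (M := Submonoid.powers (diag3 k)) (f := toLoc3.comp (substU3 w)) (by
    rintro ⟨_, m, rfl⟩
    simpa using (isUnit_substU3 w).pow m)

theorem scalarU3_toLoc3 (w : (PowerSeries k)ˣ) (p : Ser3 k) :
    scalarU3 w (toLoc3 p) = toLoc3 (substU3 w p) :=
  IsLocalization.lift_eq _ _

theorem scalarU3_comp_scalarIJ (w : (PowerSeries k)ˣ) (i j : Fin 3) (hij : i < j) :
    (scalarU3 w).comp (scalarIJ i j hij) = (scalarIJ i j hij).comp (scalarU w) := by
  apply Loc2_algHom_ext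
  intro p
  simp only [AlgHom.comp_apply, scalarIJ_toLoc2, scalarU_toLoc2, scalarU3_toLoc3]
  rw [← AlgHom.comp_apply (substU3 w), substU3_comp_subst3, AlgHom.comp_apply]

/-- `f(z) ↦ f(zᵢ)`. -/
def atVar3 (i : Fin 3) : PowerSeries k →ₐ[k] Loc3 k :=
  toLoc3.comp (PowerSeries.substAlgHom (S := k) (PowerSeries.HasSubst.X i))

theorem scalarIJ_comp_atVar (i j : Fin 3) (hij : i < j) (s : Fin 2) :
    (scalarIJ i j hij).comp (atVar s) = atVar3 (k := k) (![i, j] s) := by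
  apply AlgHom.ext
  intro f
  simp only [AlgHom.comp_apply, atVar, atVar3, scalarIJ_toLoc2, PowerSeries.coe_substAlgHom]
  rw [subst3_powerSeries_subst _ _ _ (PowerSeries.HasSubst.X s), subst3_X]

end Naturality

section NaturalityOfCYB

variable {k : Type u} [Field k] {A : Type v} [Ring A] [Algebra k A]

/-- The inclusion of `A` as the `i`-th tensor factor of `A ⊗ A ⊗ A`. -/
def incl3 (i : Fin 3) : A →ₐ[k] A ⊗[k] (A ⊗[k] A) :=
  ![Algebra.TensorProduct.includeLeft,
    Algebra.TensorProduct.includeRight.comp (incl 0),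
    Algebra.TensorProduct.includeRight.comp (incl 1)] i

theorem commute_map_map {R R' : Type*} [CommRing R] [Algebra k R] [CommRing R'] [Algebra k R']
    {B : Type*} [Ring B] [Algebra k B] (f f' : R →ₐ[k] R') (g g' : A →ₐ[k] B)
    (h : ∀ a b, Commute (g a) (g' b)) (x y : R ⊗[k] A) :
    Commute (Algebra.TensorProduct.map f g x) (Algebra.TensorProduct.map f' g' y) := by
  induction x with
  | zero => simp
  | add x₁ x₂ h₁ h₂ => rw [map_add]; exact h₁.add_left h₂
  | tmul r a =>
    induction y with
    | zero => simp
    | add y₁ y₂ h₁ h₂ => rw [map_add]; exact h₁.add_right h₂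
    | tmul s b =>
      simp only [Algebra.TensorProduct.map_tmul, Commute, SemiconjBy,
        Algebra.TensorProduct.tmul_mul_tmul, mul_comm (f r), (h a b).eq]

theorem commute_incl (a b : A) : Commute (incl (k := k) 0 a) (incl 1 b) := by
  simp [incl, Commute, SemiconjBy]

theorem commute_includeLeft {R : Type*} [CommRing R] [Algebra k R]
    {B : Type*} [Ring B] [Algebra k B] (r : R) (x : R ⊗[k] B) :
    Commute (Algebra.TensorProduct.includeLeft (R := k) (S := k) (B := B) r) x := by
  induction x with
  | zero => simp
  | add x₁ x₂ h₁ h₂ => exact h₁.add_right h₂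
  | tmul s b => simp [Commute, SemiconjBy, mul_comm r]

theorem commute_lift {B C D : Type*} [Ring B] [Algebra k B] [Ring C] [Algebra k C] [Ring D]
    [Algebra k D] (f : B →ₐ[k] D) (g : C →ₐ[k] D) (h : ∀ b c, Commute (f b) (g c)) (d : D)
    (hf : ∀ b, Commute d (f b)) (hg : ∀ c, Commute d (g c)) (x : B ⊗[k] C) :
    Commute d (Algebra.TensorProduct.lift f g h x) := by
  induction x with
  | zero => simp
  | add x₁ x₂ h₁ h₂ => rw [map_add]; exact h₁.add_right h₂
  | tmul b c => rw [Algebra.TensorProduct.lift_tmul]; exact (hf b).mul_right (hg c)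

section GenericRings

variable {R₂ R₃ : Type*} [CommRing R₂] [Algebra k R₂] [CommRing R₃] [Algebra k R₃]
  (φ : PowA k A ≃ₐ[PowerSeries k] PowA k A) (at₂ : Fin 2 → PowerSeries k →ₐ[k] R₂)
  (at₃ : Fin 3 → PowerSeries k →ₐ[k] R₃) (u₂ : R₂ →ₐ[k] R₂) (u₃ : R₃ →ₐ[k] R₃)

/-- `A → R₂ ⊗ (A ⊗ A)`, applying `φ` at the `i`-th variable in the `i`-th tensor factor. -/
def genAut2 (i : Fin 2) : A →ₐ[k] R₂ ⊗[k] (A ⊗[k] A) :=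
  (Algebra.TensorProduct.map (at₂ i) (incl i)).comp
    ((φ.toAlgHom.restrictScalars k).comp Algebra.TensorProduct.includeRight)

variable {B : Type*} [Ring B] [Algebra k B] (ι : Fin 3 → A →ₐ[k] B)

/-- `A → R₃ ⊗ B`, applying `φ` at the `i`-th variable followed by `ι i`. -/
def genAut3 (i : Fin 3) : A →ₐ[k] R₃ ⊗[k] B :=
  (Algebra.TensorProduct.map (at₃ i) (ι i)).comp
    ((φ.toAlgHom.restrictScalars k).comp Algebra.TensorProduct.includeRight)

theorem commute_genAut2 (a b : A) : Commute (genAut2 φ at₂ 0 a) (genAut2 φ at₂ 1 b) :=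
  commute_map_map (at₂ 0) (at₂ 1) (incl 0) (incl 1) commute_incl _ _

/-- `a ⊗ b ↦ φ(x)(a) ⊗ φ(y)(b)`. -/
def genPair : A ⊗[k] A →ₐ[k] R₂ ⊗[k] (A ⊗[k] A) :=
  Algebra.TensorProduct.lift (genAut2 φ at₂ 0) (genAut2 φ at₂ 1) (commute_genAut2 φ at₂)

/-- `φ(x) ⊗ φ(y)` together with the change of variables `u₂`, as an algebra homomorphism. -/
def transport2 : R₂ ⊗[k] (A ⊗[k] A) →ₐ[k] R₂ ⊗[k] (A ⊗[k] A) :=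
  Algebra.TensorProduct.lift (Algebra.TensorProduct.includeLeft.comp u₂) (genPair φ at₂)
    (fun _ _ => commute_includeLeft _ _)

theorem transport2_tmul (s : R₂) (a b : A) :
    transport2 φ at₂ u₂ (s ⊗ₜ (a ⊗ₜ b)) =
      (u₂ s ⊗ₜ 1) * (genAut2 φ at₂ 0 a * genAut2 φ at₂ 1 b) := by
  simp [transport2, genPair]

theorem exists_algHom_lift {B C D : Type*} [Ring B] [Algebra k B] [Ring C] [Algebra k C]
    [Ring D] [Algebra k D] (f : B →ₐ[k] D) (g : C →ₐ[k] D) (h : ∀ b c, Commute (f b) (g c)) :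
    ∃ T : B ⊗[k] C →ₐ[k] D, (∀ b c, T (b ⊗ₜ c) = f b * g c) ∧
      ∀ d, (∀ b, Commute d (f b)) → (∀ c, Commute d (g c)) → ∀ x, Commute d (T x) :=
  ⟨Algebra.TensorProduct.lift f g h, Algebra.TensorProduct.lift_tmul f g h,
    commute_lift f g h⟩

theorem exists_algHom_triple {D : Type*} [Ring D] [Algebra k D] (f : Fin 3 → A →ₐ[k] D)
    (hf : ∀ i j, i < j → ∀ a b, Commute (f i a) (f j b)) :
    ∃ T : A ⊗[k] (A ⊗[k] A) →ₐ[k] D, ∀ i a, T (incl3 i a) = f i a := by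
  obtain ⟨T₁, hT₁, hc⟩ := exists_algHom_lift (f 1) (f 2) (hf 1 2 (by decide))
  obtain ⟨T, hT, -⟩ := exists_algHom_lift (f 0) T₁
    (fun a => hc (f 0 a) (hf 0 1 (by decide) a) (hf 0 2 (by decide) a))
  have h : ∀ a b c, T (a ⊗ₜ (b ⊗ₜ c)) = f 0 a * (f 1 b * f 2 c) := fun a b c => by
    rw [← hT₁ b c]
    exact hT a _
  refine ⟨T, fun i a => ?_⟩
  fin_cases i
  · exact (h a 1 1).trans (by simp)
  · exact (h 1 a 1).trans (by simp)
  · exact (h 1 1 a).trans (by simp)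

/-- Maps `R₂ ⊗ (A ⊗ A) → R₃ ⊗ B` of the form `r ↦ rⁱʲ(zᵢ,zⱼ)` are natural. -/
theorem exists_transport3 (hι : ∀ i j, i < j → ∀ a b, Commute (ι i a) (ι j b)) :
    ∃ Ψ : R₃ ⊗[k] (A ⊗[k] (A ⊗[k] A)) →ₐ[k] R₃ ⊗[k] B,
      ∀ (i j : Fin 3) (σ : R₂ →ₐ[k] R₃) (l : A ⊗[k] A →ₐ[k] A ⊗[k] (A ⊗[k] A))
        (l' : A ⊗[k] A →ₐ[k] B), (∀ s, σ.comp (at₂ s) = at₃ (![i, j] s)) →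
        u₃.comp σ = σ.comp u₂ → (∀ s, l.comp (incl s) = incl3 (![i, j] s)) →
        (∀ s, l'.comp (incl s) = ι (![i, j] s)) → ∀ r,
        Ψ (Algebra.TensorProduct.map σ l r) =
          Algebra.TensorProduct.map σ l' (transport2 φ at₂ u₂ r) := by
  -- `T` is `φ(z₁) ⊗ φ(z₂) ⊗ φ(z₃)`, and `Ψ` is `T` combined with the change of variables `u₃`. It
  -- remains to compare on pure tensors.
  obtain ⟨T, hT⟩ := exists_algHom_triple (genAut3 φ at₃ ι) (fun i j hij a b =>
    commute_map_map (at₃ i) (at₃ j) (ι i) (ι j) (hι i j hij) _ _)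
  obtain ⟨Ψ, hΨ, -⟩ := exists_algHom_lift
    ((Algebra.TensorProduct.includeLeft (R := k) (S := k) (A := R₃) (B := B)).comp u₃) T
    (fun _ _ => commute_includeLeft _ _)
  refine ⟨Ψ, ?_⟩
  intro i j σ l l' hσ hu hl hl' r
  have hA : ∀ (s : Fin 2) (a : A),
      Algebra.TensorProduct.map σ l' (genAut2 φ at₂ s a) = genAut3 φ at₃ ι (![i, j] s) a := by
    intro s a
    rw [genAut2, genAut3, ← hl' s, ← hσ s, Algebra.TensorProduct.map_comp]
    rfl
  have hli : ∀ s a, l (incl s a) = incl3 (![i, j] s) a := fun s a =>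
    DFunLike.congr_fun (hl s) a
  induction r with
  | zero => simp only [map_zero]
  | add x y hx hy => simp only [map_add, hx, hy]
  | tmul s t =>
    induction t with
    | zero => simp only [TensorProduct.tmul_zero, map_zero]
    | add x y hx hy => simp only [TensorProduct.tmul_add, map_add, hx, hy]
    | tmul a b =>
      have hab : a ⊗ₜ[k] b = incl 0 a * incl 1 b := by simp [incl]
      have hs : u₃ (σ s) = σ (u₂ s) := DFunLike.congr_fun hu s
      have h2 : transport2 φ at₂ u₂ (s ⊗ₜ (a ⊗ₜ b)) =
          (u₂ s ⊗ₜ 1) * (genAut2 φ at₂ 0 a * genAut2 φ at₂ 1 b) :=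
        transport2_tmul φ at₂ u₂ s a b
      have h3 : T (l (a ⊗ₜ b)) = genAut3 φ at₃ ι (![i, j] 0) a * genAut3 φ at₃ ι (![i, j] 1) b := by
        rw [hab, map_mul l, hli, hli, map_mul T, hT, hT]
      have h4 : Ψ (σ s ⊗ₜ l (a ⊗ₜ b)) = (u₃ (σ s) ⊗ₜ 1) * T (l (a ⊗ₜ b)) := hΨ _ _
      have h5 : Algebra.TensorProduct.map σ l' (u₂ s ⊗ₜ 1) = u₃ (σ s) ⊗ₜ 1 := by
        rw [hs]; simp
      rw [h2, map_mul, map_mul, hA, hA, ← h3, h5, ← h4]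
      rfl

end GenericRings

theorem commute_incl3 {i j : Fin 3} (hij : i < j) (a b : A) :
    Commute (incl3 (k := k) i a) (incl3 j b) := by
  have h : (i = 0 ∧ j = 1) ∨ (i = 0 ∧ j = 2) ∨ (i = 1 ∧ j = 2) := by
    revert i j; decide
  rcases h with ⟨rfl, rfl⟩ | ⟨rfl, rfl⟩ | ⟨rfl, rfl⟩ <;>
    simp [incl3, incl, Commute, SemiconjBy]

/-- `autTensor` is only a linear map by construction; this identification shows that the passage
between equivalent series is multiplicative. -/
theorem transport2_apply (φ : PowA k A ≃ₐ[PowerSeries k] PowA k A) (w : (PowerSeries k)ˣ)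
    (r : Tensor2 k A) :
    transport2 φ atVar (scalarU w) r =
      autTensor φ (Algebra.TensorProduct.map (scalarU w) (AlgHom.id k (A ⊗[k] A)) r) := by
  induction r using TensorProduct.induction_on with
  | zero => simp only [map_zero]
  | add x y hx hy => simp only [map_add, hx, hy]
  | tmul s t =>
    induction t using TensorProduct.induction_on with
    | zero => simp only [TensorProduct.tmul_zero, map_zero]
    | add x y hx hy => simp only [TensorProduct.tmul_add, map_add, hx, hy]
    | tmul a b =>
      have h1 : transport2 φ atVar (scalarU w) (s ⊗ₜ (a ⊗ₜ b)) =
          (scalarU w s ⊗ₜ 1) * (autAt φ 0 a * autAt φ 1 b) :=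
        transport2_tmul φ atVar (scalarU w) s a b
      rw [h1]
      rfl

theorem exists_transport3_CYB (φ : PowA k A ≃ₐ[PowerSeries k] PowA k A) (w : (PowerSeries k)ˣ) :
    ∃ Ψ : Tensor3 k A →ₐ[k] Tensor3 k A, ∀ r : Tensor2 k A,
      Ψ (leg12 k A r) = leg12 k A (transport2 φ atVar (scalarU w) r) ∧
      Ψ (leg13 k A r) = leg13 k A (transport2 φ atVar (scalarU w) r) ∧
      Ψ (leg23 k A r) = leg23 k A (transport2 φ atVar (scalarU w) r) := by
  obtain ⟨Ψ, hΨ⟩ := exists_transport3 φ atVar atVar3 (scalarU w) (scalarU3 w) incl3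
    (fun i j hij a b => commute_incl3 hij a b)
  refine ⟨Ψ, fun r => ⟨?_, ?_, ?_⟩⟩
  · exact hΨ 0 1 (scalarIJ 0 1 (by decide)) _ _
      (scalarIJ_comp_atVar 0 1 _) (scalarU3_comp_scalarIJ w 0 1 _) (by
      intro s; ext a; fin_cases s <;> simp [incl, incl3, Algebra.TensorProduct.one_def]) (by
      intro s; ext a; fin_cases s <;> simp [incl, incl3, Algebra.TensorProduct.one_def]) r
  · exact hΨ 0 2 (scalarIJ 0 2 (by decide)) _ _
      (scalarIJ_comp_atVar 0 2 _) (scalarU3_comp_scalarIJ w 0 2 _) (by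
      intro s; ext a; fin_cases s <;> simp [incl, incl3, Algebra.TensorProduct.one_def]) (by
      intro s; ext a; fin_cases s <;> simp [incl, incl3, Algebra.TensorProduct.one_def]) r
  · exact hΨ 1 2 (scalarIJ 1 2 (by decide)) _ _
      (scalarIJ_comp_atVar 1 2 _) (scalarU3_comp_scalarIJ w 1 2 _) (by
      intro s; ext a; fin_cases s <;> simp [incl, incl3]) (by
      intro s; ext a; fin_cases s <;> simp [incl, incl3]) r

/-- One algebra homomorphism `Ψ` carries all three legs of `r` to those of `s`, so `CYB s = Ψ (CYB
r)`. -/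
theorem CYB_eq_zero_of_equivalent {r s : Tensor2 k A} (h : Equivalent r s) (hr : CYB r = 0) :
    CYB s = 0 := by
  obtain ⟨φ, w, rfl⟩ := h
  obtain ⟨Ψ, hΨ⟩ := exists_transport3_CYB φ w
  rw [← transport2_apply]
  have h := congrArg Ψ hr
  rw [CYB, map_add, map_sub, map_mul, map_mul, map_mul, map_zero, (hΨ r).1, (hΨ r).2.1,
    (hΨ r).2.2] at h
  exact h

end NaturalityOfCYB

/-! ### The Yang-Baxter equation in matrix coefficients. -/

section Components

variable {k : Type u} [Field k] {n : ℕ}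

local notation "Mat" => Matrix (Fin n) (Fin n) k

/-- The matrix coefficient `X ⊗ Y ↦ X p q * Y a b`. -/
def entry2 (p q a b : Fin n) : Mat ⊗[k] Mat →ₗ[k] k :=
  TensorProduct.lift ((LinearMap.mul k k).compl₁₂ (Matrix.entryLinearMap k k p q)
    (Matrix.entryLinearMap k k a b))

/-- The matrix coefficient `X ⊗ Y ⊗ Z ↦ X p q * Y a b * Z c d`. -/
def entry3 (p q a b c d : Fin n) : Mat ⊗[k] (Mat ⊗[k] Mat) →ₗ[k] k :=
  TensorProduct.lift ((LinearMap.mul k k).compl₁₂ (Matrix.entryLinearMap k k p q)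
    (entry2 a b c d))

theorem entry2_tmul (p q a b : Fin n) (X Y : Mat) :
    entry2 p q a b (X ⊗ₜ Y) = X p q * Y a b := by
  simp [entry2]

theorem entry3_tmul (p q a b c d : Fin n) (X Y Z : Mat) :
    entry3 p q a b c d (X ⊗ₜ (Y ⊗ₜ Z)) = X p q * (Y a b * Z c d) := by
  simp [entry3, entry2]

variable {R₂ R₃ : Type*} [CommRing R₂] [Algebra k R₂] [CommRing R₃] [Algebra k R₃]

/-- The matrix coefficients of an element of `R ⊗ (A ⊗ A)`. -/
def comp2 (p q a b : Fin n) : R₂ ⊗[k] (Mat ⊗[k] Mat) →ₗ[k] R₂ :=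
  TensorProduct.lift ((LinearMap.lsmul k R₂).flip.compl₂ (entry2 p q a b))

/-- The matrix coefficients of an element of `R ⊗ (A ⊗ A ⊗ A)`. -/
def comp3 (p q a b c d : Fin n) : R₃ ⊗[k] (Mat ⊗[k] (Mat ⊗[k] Mat)) →ₗ[k] R₃ :=
  TensorProduct.lift ((LinearMap.lsmul k R₃).flip.compl₂ (entry3 p q a b c d))

theorem comp2_tmul (p q a b : Fin n) (s : R₂) (t : Mat ⊗[k] Mat) :
    comp2 p q a b (s ⊗ₜ t) = entry2 p q a b t • s := by
  simp [comp2]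

theorem comp3_tmul (p q a b c d : Fin n) (s : R₃) (t : Mat ⊗[k] (Mat ⊗[k] Mat)) :
    comp3 p q a b c d (s ⊗ₜ t) = entry3 p q a b c d t • s := by
  simp [comp3]

variable (σ₁ σ₂ : R₂ →ₐ[k] R₃)

theorem tensor2_induction {R : Type*} [CommRing R] [Algebra k R]
    {P : R ⊗[k] (Mat ⊗[k] Mat) → Prop} (r : R ⊗[k] (Mat ⊗[k] Mat)) (h0 : P 0)
    (hadd : ∀ x y, P x → P y → P (x + y)) (h : ∀ s X Y, P (s ⊗ₜ (X ⊗ₜ Y))) : P r := by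
  induction r with
  | zero => exact h0
  | add x y hx hy => exact hadd x y hx hy
  | tmul s t =>
    induction t with
    | zero => rw [TensorProduct.tmul_zero]; exact h0
    | add x y hx hy => rw [TensorProduct.tmul_add]; exact hadd _ _ hx hy
    | tmul X Y => exact h s X Y

theorem comp3_leg13_mul_leg12 (p q a b c d : Fin n) (r r' : R₂ ⊗[k] (Mat ⊗[k] Mat)) :
    comp3 p q a b c d
      (Algebra.TensorProduct.map σ₁ (Algebra.TensorProduct.map (AlgHom.id k Mat)
          (Algebra.TensorProduct.includeRight : Mat →ₐ[k] Mat ⊗[k] Mat)) r *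
        Algebra.TensorProduct.map σ₂ (Algebra.TensorProduct.map (AlgHom.id k Mat)
          (Algebra.TensorProduct.includeLeft : Mat →ₐ[k] Mat ⊗[k] Mat)) r') =
      ∑ o, σ₁ (comp2 p o c d r) * σ₂ (comp2 o q a b r') := by
  induction r using tensor2_induction with
  | h0 => simp only [map_zero, zero_mul, Finset.sum_const_zero]
  | hadd x y hx hy => simp only [map_add, add_mul, hx, hy, Finset.sum_add_distrib]
  | h s X Y =>
    induction r' using tensor2_induction with
    | h0 => simp only [map_zero, mul_zero, Finset.sum_const_zero]
    | hadd x y hx hy => simp only [map_add, mul_add, hx, hy, Finset.sum_add_distrib]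
    | h s' X' Y' =>
      simp only [Algebra.TensorProduct.map_tmul, Algebra.TensorProduct.tmul_mul_tmul, comp3_tmul,
        comp2_tmul, Algebra.TensorProduct.includeRight_apply,
        Algebra.TensorProduct.includeLeft_apply, entry3_tmul, entry2_tmul]
      simp only [one_mul, mul_one]
      simp only [map_smul, AlgHom.id_apply, Matrix.mul_apply, Finset.sum_mul, Finset.sum_smul,
        smul_mul_smul_comm]
      exact Finset.sum_congr rfl fun o _ => by congr 1; ring

theorem comp3_leg12_mul_leg23 (p q a b c d : Fin n) (r r' : R₂ ⊗[k] (Mat ⊗[k] Mat)) :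
    comp3 p q a b c d
      (Algebra.TensorProduct.map σ₁ (Algebra.TensorProduct.map (AlgHom.id k Mat)
          (Algebra.TensorProduct.includeLeft : Mat →ₐ[k] Mat ⊗[k] Mat)) r *
        Algebra.TensorProduct.map σ₂
          (Algebra.TensorProduct.includeRight : Mat ⊗[k] Mat →ₐ[k] Mat ⊗[k] (Mat ⊗[k] Mat)) r') =
      ∑ o, σ₁ (comp2 p q a o r) * σ₂ (comp2 o b c d r') := by
  induction r using tensor2_induction with
  | h0 => simp only [map_zero, zero_mul, Finset.sum_const_zero]
  | hadd x y hx hy => simp only [map_add, add_mul, hx, hy, Finset.sum_add_distrib]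
  | h s X Y =>
    induction r' using tensor2_induction with
    | h0 => simp only [map_zero, mul_zero, Finset.sum_const_zero]
    | hadd x y hx hy => simp only [map_add, mul_add, hx, hy, Finset.sum_add_distrib]
    | h s' X' Y' =>
      simp only [Algebra.TensorProduct.map_tmul, Algebra.TensorProduct.tmul_mul_tmul, comp3_tmul,
        comp2_tmul, Algebra.TensorProduct.includeRight_apply,
        Algebra.TensorProduct.includeLeft_apply, entry3_tmul, entry2_tmul]
      simp only [one_mul, mul_one, AlgHom.id_apply]
      simp only [map_smul, Matrix.mul_apply, Finset.sum_mul, Finset.mul_sum, Finset.sum_smul,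
        smul_mul_smul_comm]
      exact Finset.sum_congr rfl fun o _ => by congr 1; ring

theorem comp3_leg23_mul_leg13 (p q a b c d : Fin n) (r r' : R₂ ⊗[k] (Mat ⊗[k] Mat)) :
    comp3 p q a b c d
      (Algebra.TensorProduct.map σ₁
          (Algebra.TensorProduct.includeRight : Mat ⊗[k] Mat →ₐ[k] Mat ⊗[k] (Mat ⊗[k] Mat)) r *
        Algebra.TensorProduct.map σ₂ (Algebra.TensorProduct.map (AlgHom.id k Mat)
          (Algebra.TensorProduct.includeRight : Mat →ₐ[k] Mat ⊗[k] Mat)) r') =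
      ∑ o, σ₁ (comp2 a b c o r) * σ₂ (comp2 p q o d r') := by
  induction r using tensor2_induction with
  | h0 => simp only [map_zero, zero_mul, Finset.sum_const_zero]
  | hadd x y hx hy => simp only [map_add, add_mul, hx, hy, Finset.sum_add_distrib]
  | h s X Y =>
    induction r' using tensor2_induction with
    | h0 => simp only [map_zero, mul_zero, Finset.sum_const_zero]
    | hadd x y hx hy => simp only [map_add, mul_add, hx, hy, Finset.sum_add_distrib]
    | h s' X' Y' =>
      simp only [Algebra.TensorProduct.map_tmul, Algebra.TensorProduct.tmul_mul_tmul, comp3_tmul,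
        comp2_tmul, Algebra.TensorProduct.includeRight_apply, entry3_tmul, entry2_tmul]
      simp only [one_mul, mul_one, AlgHom.id_apply]
      simp only [map_smul, Matrix.mul_apply, Finset.mul_sum, Finset.sum_smul,
        smul_mul_smul_comm]
      exact Finset.sum_congr rfl fun o _ => by congr 1; ring

/-- The Yang-Baxter equation in terms of matrix coefficients. -/
theorem CYB_components (r : Tensor2 k Mat) (hr : CYB r = 0) (p q a b c d : Fin n) :
    ∑ o, scalarIJ 0 2 (by decide) (comp2 p o c d r) * scalarIJ 0 1 (by decide) (comp2 o q a b r) -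
      ∑ o, scalarIJ 0 1 (by decide) (comp2 p q a o r) * scalarIJ 1 2 (by decide) (comp2 o b c d r) +
      ∑ o, scalarIJ 1 2 (by decide) (comp2 a b c o r) *
        scalarIJ 0 2 (by decide) (comp2 p q o d r) = 0 := by
  have h1 := comp3_leg13_mul_leg12 (scalarIJ (k := k) 0 2 (by decide))
    (scalarIJ 0 1 (by decide)) p q a b c d r r
  have h2 := comp3_leg12_mul_leg23 (scalarIJ (k := k) 0 1 (by decide))
    (scalarIJ 1 2 (by decide)) p q a b c d r r
  have h3 := comp3_leg23_mul_leg13 (scalarIJ (k := k) 1 2 (by decide))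
    (scalarIJ 0 2 (by decide)) p q a b c d r r
  rw [← h1, ← h2, ← h3, ← map_sub, ← map_add]
  exact (congrArg (comp3 p q a b c d) hr).trans (map_zero _)
end Components

/-! ### Exponential series and Laurent polynomials in exponentials. -/

section Exponentials

variable {k : Type u} [Field k]

/-- As `F` does not involve the variable `s` and the other factor involves nothing else, only one
splitting of the exponent `e` contributes. -/
theorem coeff_mul_subst_X {τ : Type*} [DecidableEq τ] (F : MvPowerSeries τ k) (s : τ)
    (hF : ∀ e : τ →₀ ℕ, e s ≠ 0 → MvPowerSeries.coeff e F = 0) (f : PowerSeries k) (e : τ →₀ ℕ) :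
    MvPowerSeries.coeff e (F * PowerSeries.subst (MvPowerSeries.X s : MvPowerSeries τ k) f) =
      MvPowerSeries.coeff (e.erase s) F * PowerSeries.coeff (e s) f := by
  rw [MvPowerSeries.coeff_mul, Finset.sum_eq_single (e.erase s, Finsupp.single s (e s))]
  · rw [PowerSeries.coeff_subst_single]
    simp
  · rintro ⟨a, b⟩ hab hne
    rw [Finset.HasAntidiagonal.mem_antidiagonal] at hab
    rw [PowerSeries.coeff_subst_single]
    split_ifs with hb
    · rw [hF a, zero_mul]
      intro ha
      apply hne
      have h1 : e s = b s := by rw [← hab]; simp [ha]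
      have hb' : b = Finsupp.single s (e s) := by rw [h1]; exact hb
      have ha' : a = e.erase s := by
        ext t
        by_cases hts : t = s
        · rw [hts, ha, Finsupp.erase_same]
        · rw [Finsupp.erase_ne hts, ← hab, hb', Finsupp.add_apply, Finsupp.single_eq_of_ne hts,
            add_zero]
      rw [ha', hb']
    · rw [mul_zero]
  · intro h
    exact absurd (Finset.HasAntidiagonal.mem_antidiagonal.mpr (Finsupp.erase_add_single s e)) h

/-- Induction on `S`, one variable at a time. The first clause is carried along because it is the
hypothesis of `coeff_mul_subst_X`. -/
theorem coeff_prod_subst_X {τ : Type*} [DecidableEq τ] (S : Finset τ) (f : τ → PowerSeries k) :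
    (∀ e : τ →₀ ℕ, (∃ s ∉ S, e s ≠ 0) → MvPowerSeries.coeff e
      (∏ s ∈ S, PowerSeries.subst (MvPowerSeries.X s : MvPowerSeries τ k) (f s)) = 0) ∧
    (∀ e : τ →₀ ℕ, (∀ s ∉ S, e s = 0) → MvPowerSeries.coeff e
      (∏ s ∈ S, PowerSeries.subst (MvPowerSeries.X s : MvPowerSeries τ k) (f s)) =
        ∏ s ∈ S, PowerSeries.coeff (e s) (f s)) := by
  induction S using Finset.induction_on with
  | empty =>
    constructor
    · rintro e ⟨s, -, hs⟩
      rw [Finset.prod_empty, MvPowerSeries.coeff_one, if_neg]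
      rintro rfl
      exact hs rfl
    · intro e he
      have : e = 0 := Finsupp.ext fun s => he s (Finset.notMem_empty s)
      simp [this]
  | insert a S ha ih =>
    have h0 : ∀ e : τ →₀ ℕ, e a ≠ 0 → MvPowerSeries.coeff e
      (∏ s ∈ S, PowerSeries.subst (MvPowerSeries.X s : MvPowerSeries τ k) (f s)) = 0 :=
      fun e he => ih.1 e ⟨a, ha, he⟩
    rw [Finset.prod_insert ha, mul_comm]
    constructor
    · rintro e ⟨s, hs, hes⟩
      rw [Finset.mem_insert, not_or] at hs
      rw [coeff_mul_subst_X _ _ h0, ih.1 _ ⟨s, hs.2, by rwa [Finsupp.erase_ne hs.1]⟩, zero_mul]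
    · intro e he
      rw [coeff_mul_subst_X _ _ h0, ih.2, Finset.prod_insert ha, mul_comm]
      · congr 1
        refine Finset.prod_congr rfl fun s hs => ?_
        rw [Finsupp.erase_ne (by rintro rfl; exact ha hs)]
      · intro s hs
        by_cases hsa : s = a
        · rw [hsa, Finsupp.erase_same]
        · rw [Finsupp.erase_ne hsa]
          exact he s (by simp [hsa, hs])

variable [CharZero k]

/-- The universal case of the functional equation, where comparing coefficients gives `C(i+j,i) /
(i+j)! = 1 / (i! j!)`. The general case `exp_subst_add` follows by substitution. -/
theorem exp_subst_X_add_X :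
    PowerSeries.subst (MvPowerSeries.X 0 + MvPowerSeries.X 1 : Ser2 k) (PowerSeries.exp k) =
      PowerSeries.subst (MvPowerSeries.X 0 : Ser2 k) (PowerSeries.exp k) *
        PowerSeries.subst (MvPowerSeries.X 1 : Ser2 k) (PowerSeries.exp k) := by
  ext e
  have h := (coeff_prod_subst_X (k := k) (Finset.univ : Finset (Fin 2))
    (fun _ => PowerSeries.exp k)).2 e (by simp)
  rw [Fin.prod_univ_two, Fin.prod_univ_two] at h
  rw [h, PowerSeries.coeff_subst (PowerSeries.HasSubst.of_constantCoeff_zero (by simp))]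
  have hpow : ∀ d : ℕ, MvPowerSeries.coeff e ((MvPowerSeries.X 0 + MvPowerSeries.X 1 : Ser2 k) ^ d) =
      if d = e 0 + e 1 then ((d.choose (e 0) : ℕ) : k) else 0 := by
    intro d
    rw [add_pow, map_sum]
    have h1 : ∀ j ∈ Finset.range (d + 1), MvPowerSeries.coeff e
        ((MvPowerSeries.X 0 : Ser2 k) ^ j * MvPowerSeries.X 1 ^ (d - j) * (d.choose j : Ser2 k)) =
        if j = e 0 ∧ d = e 0 + e 1 then ((d.choose (e 0) : ℕ) : k) else 0 := by
      intro j hj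
      have hj' : j ≤ d := Nat.lt_succ_iff.mp (Finset.mem_range.mp hj)
      have hc : ((d.choose j : ℕ) : Ser2 k) = MvPowerSeries.C ((d.choose j : ℕ) : k) := by simp
      rw [hc, mul_comm, MvPowerSeries.coeff_C_mul, MvPowerSeries.X_pow_eq, MvPowerSeries.X_pow_eq,
        MvPowerSeries.monomial_mul_monomial, MvPowerSeries.coeff_monomial]
      have he : e = Finsupp.single 0 j + Finsupp.single 1 (d - j) ↔ j = e 0 ∧ d = e 0 + e 1 := by
        constructor
        · intro h
          have h0 := DFunLike.congr_fun h 0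
          have h1 := DFunLike.congr_fun h 1
          simp at h0 h1
          omega
        · rintro ⟨h0, h1⟩
          ext t
          fin_cases t <;> simp <;> omega
      simp only [he]
      split_ifs with h2
      · rw [h2.1]; simp
      · simp
    rw [Finset.sum_congr rfl h1]
    by_cases hd : d = e 0 + e 1
    · simp [hd]
    · simp [hd]
  rw [finsum_eq_single _ (e 0 + e 1)]
  · rw [hpow, if_pos rfl]
    simp only [PowerSeries.coeff_exp, smul_eq_mul]
    have h0 : (((e 0 + e 1).choose (e 0) : ℕ) : k) * (e 0).factorial * (e 1).factorial =
        (e 0 + e 1).factorial := by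
      rw [Nat.choose_symm_add]
      exact_mod_cast Nat.add_choose_mul_factorial_mul_factorial (e 0) (e 1)
    have h1 : ((e 0 + e 1).factorial : k) ≠ 0 := by exact_mod_cast (Nat.factorial_pos _).ne'
    have h2 : ((e 0).factorial : k) ≠ 0 := by exact_mod_cast (Nat.factorial_pos _).ne'
    have h3 : ((e 1).factorial : k) ≠ 0 := by exact_mod_cast (Nat.factorial_pos _).ne'
    simp only [one_div, map_inv₀, map_natCast]
    field_simp
    linear_combination h0
  · intro d hd
    rw [hpow, if_neg hd, smul_zero]

theorem exp_subst_add {τ : Type*} (p q : MvPowerSeries τ k)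
    (hp : MvPowerSeries.constantCoeff p = 0) (hq : MvPowerSeries.constantCoeff q = 0) :
    PowerSeries.subst (p + q) (PowerSeries.exp k) =
      PowerSeries.subst p (PowerSeries.exp k) * PowerSeries.subst q (PowerSeries.exp k) := by
  have hpq : MvPowerSeries.HasSubst ![p, q] :=
    MvPowerSeries.hasSubst_of_constantCoeff_zero (by intro s; fin_cases s <;> simp [hp, hq])
  have h : ∀ r : Ser2 k, PowerSeries.HasSubst r →
      MvPowerSeries.subst ![p, q] (PowerSeries.subst r (PowerSeries.exp k)) =
        PowerSeries.subst (MvPowerSeries.subst ![p, q] r) (PowerSeries.exp k) := fun r hr =>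
    MvPowerSeries.subst_comp_subst_apply hr.const hpq _
  have h1 := congrArg (MvPowerSeries.subst ![p, q]) (exp_subst_X_add_X (k := k))
  rw [MvPowerSeries.subst_mul hpq, h _ (PowerSeries.HasSubst.of_constantCoeff_zero (by simp)),
    h _ (PowerSeries.HasSubst.X 0), h _ (PowerSeries.HasSubst.X 1), MvPowerSeries.subst_add hpq,
    MvPowerSeries.subst_X hpq, MvPowerSeries.subst_X hpq] at h1
  exact h1

theorem exp_subst_zero {τ : Type*} :
    PowerSeries.subst (0 : MvPowerSeries τ k) (PowerSeries.exp k) = 1 := by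
  rw [PowerSeries.subst_zero_eq_C_constantCoeff]; simp

/-- The unit `exp(c zₛ)`. -/
def expUnit {τ : Type*} (c : k) (s : τ) : (MvPowerSeries τ k)ˣ where
  val := PowerSeries.subst (c • MvPowerSeries.X s : MvPowerSeries τ k) (PowerSeries.exp k)
  inv := PowerSeries.subst (-(c • MvPowerSeries.X s) : MvPowerSeries τ k) (PowerSeries.exp k)
  val_inv := by rw [← exp_subst_add _ _ (by simp) (by simp), add_neg_cancel, exp_subst_zero]
  inv_val := by rw [← exp_subst_add _ _ (by simp) (by simp), neg_add_cancel, exp_subst_zero]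

theorem expUnit_add {τ : Type*} (c d : k) (s : τ) :
    expUnit (c + d) s = expUnit c s * expUnit d s := by
  ext1
  simp only [expUnit, Units.val_mul, add_smul]
  exact exp_subst_add _ _ (by simp) (by simp)

theorem expUnit_zpow {τ : Type*} (c : k) (s : τ) (j : ℤ) :
    expUnit c s ^ j = expUnit ((j : k) * c) s := by
  let f : Multiplicative k →* (MvPowerSeries τ k)ˣ :=
    MonoidHom.mk' (fun c => expUnit (Multiplicative.toAdd c) s) (fun a b => expUnit_add _ _ s)
  have h := map_zpow f (Multiplicative.ofAdd c) j
  rw [← ofAdd_zsmul, zsmul_eq_mul] at h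
  exact h.symm

end Exponentials

section Laurent

variable (k : Type u) [Field k] (ι : Type) [Fintype ι]

/-- Laurent polynomials in the variables indexed by `ι`. -/
abbrev Laurent : Type u := AddMonoidAlgebra k (ι → ℤ)

variable {k ι}

section Evaluation

variable {R : Type*} [CommRing R] [Algebra k R] {R' : Type*} [CommRing R'] [Algebra k R']

/-- The monomial character `g ↦ ∏ᵢ wᵢ ^ gᵢ`. -/
def monomialHom (w : ι → Rˣ) : Multiplicative (ι → ℤ) →* R where
  toFun g := ((∏ i, w i ^ (Multiplicative.toAdd g i) : Rˣ) : R)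
  map_one' := by simp
  map_mul' g h := by
    simp [zpow_add, Finset.prod_mul_distrib]

/-- Evaluation of a Laurent polynomial at units. -/
def Laurent.ev (w : ι → Rˣ) : Laurent k ι →ₐ[k] R :=
  AddMonoidAlgebra.lift k R (ι → ℤ) (monomialHom w)

theorem Laurent.ev_single (w : ι → Rˣ) (g : ι → ℤ) (c : k) :
    Laurent.ev w (AddMonoidAlgebra.single g c) = c • ((∏ i, w i ^ g i : Rˣ) : R) := by
  rw [Laurent.ev, AddMonoidAlgebra.lift_single]
  rfl

theorem Laurent.map_ev (f : R →ₐ[k] R') (w : ι → Rˣ) (D : Laurent k ι) :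
    f (Laurent.ev w D) = Laurent.ev (fun i => Units.map (f : R →* R') (w i)) D := by
  have h : f.comp (Laurent.ev w) = Laurent.ev (fun i => Units.map (f : R →* R') (w i)) := by
    refine AddMonoidAlgebra.algHom_ext (fun g => ?_) (Subsingleton.elim _ _)
    rw [AlgHom.comp_apply, Laurent.ev_single, Laurent.ev_single, map_smul]
    congr 1
    have h : Units.map (f : R →* R') (∏ i, w i ^ g i) =
        ∏ i, (Units.map (f : R →* R') (w i)) ^ g i := by
      rw [map_prod]
      simp only [map_zpow]
    exact congrArg Units.val h
  exact DFunLike.congr_fun h D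

end Evaluation

/-- The variables as units of the ring of Laurent polynomials. -/
def Laurent.X [DecidableEq ι] (i : ι) : (Laurent k ι)ˣ where
  val := AddMonoidAlgebra.single (Pi.single i 1) 1
  inv := AddMonoidAlgebra.single (-Pi.single i 1) 1
  val_inv := by
    rw [AddMonoidAlgebra.single_mul_single, add_neg_cancel, mul_one]; rfl
  inv_val := by
    rw [AddMonoidAlgebra.single_mul_single, neg_add_cancel, mul_one]; rfl

theorem Laurent.map_X [DecidableEq ι] {R : Type*} [CommRing R] [Algebra k R] (w : ι → Rˣ) (i : ι) :
    Units.map ((Laurent.ev w : Laurent k ι →ₐ[k] R) : Laurent k ι →* R) (Laurent.X i) = w i := by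
  ext1
  change Laurent.ev w (AddMonoidAlgebra.single (Pi.single i 1) 1) = _
  rw [Laurent.ev_single, one_smul, Finset.prod_eq_single i]
  · simp
  · intro j _ hj; simp [hj]
  · simp

/-- Exponentials in independent variables are algebraically independent. -/
theorem Laurent.ev_expUnit_injective [DecidableEq ι] [CharZero k] (c : k) (hc : c ≠ 0) :
    Function.Injective
      (Laurent.ev (fun i => expUnit c i) : Laurent k ι →ₐ[k] MvPowerSeries ι k) := by
  -- The coefficient of `exp(c ∑ gᵢ zᵢ)` at `e` is `χ g e / e!`. Since `c ≠ 0` and the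
  -- characteristic is zero, distinct `g` give distinct characters of the monoid of exponents, and
  -- Dedekind's independence of characters applies.
  let χ : (ι → ℤ) → (Multiplicative (ι → ℕ) →* k) := fun g =>
    { toFun := fun e => ∏ i, ((g i : k) * c) ^ (Multiplicative.toAdd e i)
      map_one' := by simp
      map_mul' := fun e e' => by simp [pow_add, Finset.prod_mul_distrib] }
  have hχ : Function.Injective χ := by
    intro g h hgh
    funext i
    have h1 := DFunLike.congr_fun hgh (Multiplicative.ofAdd (Pi.single i 1))
    simp only [χ, MonoidHom.coe_mk, OneHom.coe_mk, toAdd_ofAdd] at h1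
    rw [Finset.prod_eq_single i (by intro j _ hj; simp [hj]) (by simp),
      Finset.prod_eq_single i (by intro j _ hj; simp [hj]) (by simp)] at h1
    simpa [hc] using h1
  have hli := (linearIndependent_monoidHom (Multiplicative (ι → ℕ)) k).comp χ hχ
  have hcoeff : ∀ (g : ι → ℤ) (e : ι →₀ ℕ), MvPowerSeries.coeff e
      ((∏ i, expUnit c i ^ g i : (MvPowerSeries ι k)ˣ) : MvPowerSeries ι k) =
      (∏ i, ((e i).factorial : k)⁻¹) * χ g (Multiplicative.ofAdd (e : ι → ℕ)) := by
    intro g e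
    have h := (coeff_prod_subst_X (k := k) (Finset.univ : Finset ι)
      (fun i => PowerSeries.rescale ((g i : k) * c) (PowerSeries.exp k))).2 e (by simp)
    rw [Units.coe_prod]
    have h2 : ∀ i, ((expUnit c i ^ g i : (MvPowerSeries ι k)ˣ) : MvPowerSeries ι k) =
        PowerSeries.subst (MvPowerSeries.X i : MvPowerSeries ι k)
          (PowerSeries.rescale ((g i : k) * c) (PowerSeries.exp k)) := by
      intro i
      rw [expUnit_zpow]
      change PowerSeries.subst _ _ = _
      rw [PowerSeries.rescale_eq_subst, PowerSeries.subst_comp_subst_apply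
        (PowerSeries.HasSubst.smul_X' _) (PowerSeries.HasSubst.X i),
        PowerSeries.subst_smul (PowerSeries.HasSubst.X i),
        PowerSeries.subst_X (PowerSeries.HasSubst.X i)]
    rw [Finset.prod_congr rfl fun i _ => h2 i, h]
    change _ = _ * ∏ i, ((g i : k) * c) ^ e i
    rw [← Finset.prod_mul_distrib]
    refine Finset.prod_congr rfl fun i _ => ?_
    simp [PowerSeries.coeff_rescale, PowerSeries.coeff_exp, mul_comm]
  rw [injective_iff_map_eq_zero]
  intro D hD
  have hsum : ∀ e : ι →₀ ℕ, MvPowerSeries.coeff e (Laurent.ev (fun i => expUnit c i) D) =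
      (∏ i, ((e i).factorial : k)⁻¹) *
        (D.coeff.sum fun g a => a * χ g (Multiplicative.ofAdd (e : ι → ℕ))) := by
    intro e
    rw [Laurent.ev, AddMonoidAlgebra.lift_apply, Finsupp.sum, map_sum, Finsupp.sum, Finset.mul_sum]
    refine Finset.sum_congr rfl fun g _ => ?_
    rw [map_smul, smul_eq_mul]
    change _ * MvPowerSeries.coeff e
      ((∏ i, expUnit c i ^ g i : (MvPowerSeries ι k)ˣ) : MvPowerSeries ι k) = _
    rw [hcoeff]
    ring
  have hz : D.coeff = 0 := by
    rw [linearIndependent_iff] at hli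
    apply hli
    funext e
    have h1 := hsum (Finsupp.equivFunOnFinite.symm (Multiplicative.toAdd e))
    rw [hD, map_zero] at h1
    have h2 := (mul_eq_zero.mp h1.symm).resolve_left
      (Finset.prod_ne_zero_iff.mpr fun i _ =>
        inv_ne_zero (Nat.cast_ne_zero.mpr (Nat.factorial_ne_zero _)))
    rw [Finsupp.linearCombination_apply, Finsupp.sum, Finset.sum_apply]
    exact h2
  exact AddMonoidAlgebra.ext (by simpa using hz)

end Laurent

/-! ### Clearing denominators and passing to Laurent polynomials. -/

section Cleared

variable {n : ℕ}

/-- The Yang-Baxter equation for `N / d`, multiplied by the common denominator. The indices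
`0, 1, 2` stand for the pairs `(z₁,z₂)`, `(z₁,z₃)`, `(z₂,z₃)`. -/
def Cleared {R : Type*} [CommRing R] (N : Fin 3 → Fin n → Fin n → Fin n → Fin n → R)
    (d : Fin 3 → R) : Prop :=
  ∀ p q a b c e, ∑ o, N 1 p o c e * N 0 o q a b * d 2 - ∑ o, N 0 p q a o * N 2 o b c e * d 1 +
    ∑ o, N 2 a b c o * N 1 p q o e * d 0 = 0

variable {R R' : Type*} [CommRing R] [CommRing R']
  {N : Fin 3 → Fin n → Fin n → Fin n → Fin n → R} {d : Fin 3 → R}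

theorem Cleared.map (h : Cleared N d) (f : R →+* R') :
    Cleared (fun s p q a b => f (N s p q a b)) (fun s => f (d s)) := by
  intro p q a b c e
  have := congrArg f (h p q a b c e)
  simpa only [map_add, map_sub, map_sum, map_mul, map_zero] using this

theorem Cleared.of_map (f : R →+* R') (hf : Function.Injective f)
    (h : Cleared (fun s p q a b => f (N s p q a b)) (fun s => f (d s))) : Cleared N d := by
  intro p q a b c e
  apply hf
  simpa only [map_add, map_sub, map_sum, map_mul, map_zero] using h p q a b c e

/-- Each of the three fractions `N / d` may be expanded by its own factor, since every term contains
each of the indices `0, 1, 2` exactly once. With `d = 1` this introduces the denominators; with `u =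
y⁻¹` it turns `x - y` into `x/y - 1`. -/
theorem Cleared.scale (h : Cleared N d) (u : Fin 3 → R) :
    Cleared (fun s p q a b => u s * N s p q a b) (fun s => u s * d s) := by
  intro p q a b c e
  have := congrArg (fun x => u 0 * u 1 * u 2 * x) (h p q a b c e)
  simp only [mul_zero, mul_add, mul_sub, Finset.mul_sum] at this
  rw [← this]
  congr 1
  · congr 1
    · exact Finset.sum_congr rfl fun o _ => by ring
    · exact Finset.sum_congr rfl fun o _ => by ring
  · exact Finset.sum_congr rfl fun o _ => by ring

end Cleared

section Reduction

variable {k : Type u} [Field k] {n : ℕ}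

local notation "Mat" => Matrix (Fin n) (Fin n) k

/-- The first index of each of the pairs `(0,1)`, `(0,2)`, `(1,2)`. -/
def fstIdx : Fin 3 → Fin 3 := ![0, 0, 1]

/-- The second index of each of the pairs `(0,1)`, `(0,2)`, `(1,2)`. -/
def sndIdx : Fin 3 → Fin 3 := ![1, 2, 2]

theorem fstIdx_lt_sndIdx (s : Fin 3) : fstIdx s < sndIdx s := by
  revert s; decide

theorem toLoc3_injective : Function.Injective (toLoc3 : Ser3 k →ₐ[k] Loc3 k) := by
  have hX : ∀ i j : Fin 3, i ≠ j → (MvPowerSeries.X i - MvPowerSeries.X j : Ser3 k) ≠ 0 := by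
    intro i j hij h
    have h1 := congrArg (MvPowerSeries.coeff (Finsupp.single i 1)) h
    rw [map_sub, map_zero, MvPowerSeries.coeff_X, MvPowerSeries.coeff_X, if_pos rfl, if_neg,
      sub_zero] at h1
    · exact one_ne_zero h1
    · rw [Finsupp.single_left_inj one_ne_zero]; exact hij
  have hd : diag3 k ≠ 0 := mul_ne_zero (mul_ne_zero (hX 0 1 (by decide)) (hX 0 2 (by decide)))
    (hX 1 2 (by decide))
  exact IsLocalization.injective (Loc3 k)
    (powers_le_nonZeroDivisors_of_noZeroDivisors hd)

/-- Clearing denominators in the Yang-Baxter equation. -/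
theorem cleared_of_CYB (r : Tensor2 k Mat) (hr : CYB r = 0) (d : Ser2 k)
    (N : Fin n → Fin n → Fin n → Fin n → Ser2 k)
    (hN : ∀ p q a b, toLoc2 d * comp2 p q a b r = toLoc2 (N p q a b)) :
    Cleared (fun s p q a b => subst3 (fstIdx s) (sndIdx s) (N p q a b))
      (fun s => subst3 (fstIdx s) (sndIdx s) d) := by
  have h1 : Cleared
      (fun s p q a b => scalarIJ (fstIdx s) (sndIdx s) (fstIdx_lt_sndIdx s) (comp2 p q a b r))
      (fun _ => 1) := by
    intro p q a b c e
    simp only [mul_one]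
    exact CYB_components r hr p q a b c e
  have h2 := h1.scale
    (fun s => scalarIJ (fstIdx s) (sndIdx s) (fstIdx_lt_sndIdx s) (toLoc2 d))
  have hs : ∀ s p q a b, scalarIJ (fstIdx s) (sndIdx s) (fstIdx_lt_sndIdx s) (toLoc2 d) *
      scalarIJ (fstIdx s) (sndIdx s) (fstIdx_lt_sndIdx s) (comp2 p q a b r) =
      toLoc3 (subst3 (fstIdx s) (sndIdx s) (N p q a b)) := by
    intro s p q a b
    rw [← map_mul (scalarIJ (fstIdx s) (sndIdx s) (fstIdx_lt_sndIdx s)), hN, scalarIJ_toLoc2]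
  simp only [hs, mul_one] at h2
  simp only [scalarIJ_toLoc2] at h2
  exact Cleared.of_map (toLoc3 : Ser3 k →ₐ[k] Loc3 k).toRingHom toLoc3_injective h2

/-- The Laurent polynomial `x ^ m y ^ (-m) - 1`. -/
def delta (m : ℕ) : Laurent k (Fin 2) := AddMonoidAlgebra.single ![(m : ℤ), -(m : ℤ)] 1 - 1

/-- The Yang-Baxter equation for `D / delta m`, with denominators cleared, at all units. -/
def LaurentCYBE (m : ℕ) (D : Fin n → Fin n → Fin n → Fin n → Laurent k (Fin 2)) : Prop :=
  ∀ (R : Type u) [CommRing R] [Algebra k R] (w : Fin 3 → Rˣ),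
    Cleared (fun s p q a b => Laurent.ev ![w (fstIdx s), w (sndIdx s)] (D p q a b))
      (fun s => Laurent.ev ![w (fstIdx s), w (sndIdx s)] (delta m : Laurent k (Fin 2)))

/-- The numerator of `(xᵐ y⁻ᵐ - 1)⁻¹ ∑ⱼ xʲ y⁻ʲ gⱼ + t`. -/
def numerator (m : ℕ) (g : ℕ → k) (t : Laurent k (Fin 2)) : Laurent k (Fin 2) :=
  ∑ j ∈ Finset.range m, AddMonoidAlgebra.single ![(j : ℤ), -(j : ℤ)] (g j) + delta m * t

/-- The exponentials `exp(c zᵢ)` are algebraically independent, so the identity already holds for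
the three generic units of the Laurent polynomial ring, and from there specialises to any units. -/
theorem LaurentCYBE_of_exp [CharZero k] (m : ℕ) (c : k) (hc : c ≠ 0)
    (D : Fin n → Fin n → Fin n → Fin n → Laurent k (Fin 2))
    (h : Cleared (fun s p q a b => subst3 (fstIdx s) (sndIdx s)
        (Laurent.ev (fun i => expUnit c i) (D p q a b)))
      (fun s => subst3 (fstIdx s) (sndIdx s) (Laurent.ev (fun i => expUnit c i)
        (delta m : Laurent k (Fin 2))))) :
    LaurentCYBE m D := by
  have hexp : ∀ i j : Fin 3, (fun s : Fin 2 => Units.map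
      ((subst3 i j : Ser2 k →ₐ[k] Ser3 k) : Ser2 k →* Ser3 k) (expUnit c s)) =
      ![expUnit c i, expUnit c j] := by
    intro i j
    have hs : ∀ s : Fin 2, Units.map
        ((subst3 i j : Ser2 k →ₐ[k] Ser3 k) : Ser2 k →* Ser3 k) (expUnit c s) =
        expUnit c (![i, j] s) := by
      intro s
      ext1
      change subst3 i j (PowerSeries.subst _ _) = PowerSeries.subst _ _
      rw [subst3_powerSeries_subst _ _ _ (PowerSeries.HasSubst.of_constantCoeff_zero (by simp)),
        map_smul, subst3_X]
    funext s
    rw [hs]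
    fin_cases s <;> rfl
  have hmap : ∀ {R : Type u} [CommRing R] [Algebra k R] (w : Fin 3 → Rˣ) (s : Fin 3)
      (E : Laurent k (Fin 2)),
      Laurent.ev w (Laurent.ev ![Laurent.X (k := k) (fstIdx s), Laurent.X (sndIdx s)] E) =
        Laurent.ev ![w (fstIdx s), w (sndIdx s)] E := by
    intro R _ _ w s E
    rw [Laurent.map_ev]
    congr 2
    funext i
    fin_cases i
    · exact Laurent.map_X w _
    · exact Laurent.map_X w _
  simp only [Laurent.map_ev, hexp] at h
  have hgen : Cleared (fun s p q a b =>
      Laurent.ev ![Laurent.X (k := k) (fstIdx s), Laurent.X (sndIdx s)] (D p q a b))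
      (fun s => Laurent.ev ![Laurent.X (k := k) (fstIdx s), Laurent.X (sndIdx s)]
        (delta m : Laurent k (Fin 2))) := by
    refine Cleared.of_map
      (Laurent.ev (fun i => expUnit c i) : Laurent k (Fin 3) →ₐ[k] Ser3 k).toRingHom
      (Laurent.ev_expUnit_injective c hc) ?_
    have h' := hmap (fun i : Fin 3 => (expUnit c i : (Ser3 k)ˣ))
    change Cleared (fun s p q a b => Laurent.ev _ (Laurent.ev _ (D p q a b)))
      (fun s => Laurent.ev _ (Laurent.ev _ (delta m : Laurent k (Fin 2))))
    simp only [h']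
    exact h
  intro R _ _ w
  have h2 := hgen.map (Laurent.ev w : Laurent k (Fin 3) →ₐ[k] R).toRingHom
  change Cleared (fun s p q a b => Laurent.ev w (Laurent.ev _ (D p q a b)))
      (fun s => Laurent.ev w (Laurent.ev _ (delta m : Laurent k (Fin 2)))) at h2
  simp only [hmap] at h2
  exact h2

/-- The trace is determined by vanishing on commutators and by its value at `1`, both preserved by
`σ`: off-diagonal units and differences of diagonal units are commutators, and the diagonal units
sum to `1`. Invertibility of `n` gives the value on a single diagonal unit. -/
theorem trace_algEquiv (σ : Mat ≃ₐ[k] Mat) (hn : (n : k) ≠ 0) (X : Mat) :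
    (σ X).trace = X.trace := by
  have hE : ∀ i j, i ≠ j → (σ (Matrix.single i j 1)).trace = 0 := by
    intro i j hij
    have h1 : Matrix.single i j (1 : k) = Matrix.single i i 1 * Matrix.single i j 1 := by simp
    rw [h1, map_mul, Matrix.trace_mul_comm, ← map_mul,
      Matrix.single_mul_single_of_ne _ _ _ _ hij.symm, map_zero, Matrix.trace_zero]
  have hD : ∀ i j, (σ (Matrix.single i i 1)).trace = (σ (Matrix.single j j 1)).trace := by
    intro i j
    have h1 : Matrix.single i i (1 : k) = Matrix.single i j 1 * Matrix.single j i 1 := by simp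
    have h2 : Matrix.single j j (1 : k) = Matrix.single j i 1 * Matrix.single i j 1 := by simp
    rw [h1, h2, map_mul, map_mul, Matrix.trace_mul_comm]
  have h1 : ∀ i, (σ (Matrix.single i i 1)).trace = 1 := by
    intro i
    have h := congrArg (fun M => (σ M).trace) (Matrix.sum_single_one (α := k) (m := Fin n))
    simp only [map_sum, Matrix.trace_sum, map_one, Matrix.trace_one, Fintype.card_fin] at h
    rw [Finset.sum_congr rfl fun j _ => hD j i, Finset.sum_const, Finset.card_univ,
      Fintype.card_fin, nsmul_eq_mul] at h
    exact mul_left_cancel₀ hn (h.trans (mul_one _).symm)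
  have hX : ∀ i j, (σ (Matrix.single i j (X i j))).trace = if i = j then X i j else 0 := by
    intro i j
    have h : Matrix.single i j (X i j) = X i j • Matrix.single i j (1 : k) := by simp
    rw [h, map_smul, Matrix.trace_smul, smul_eq_mul]
    split_ifs with hij
    · rw [hij, h1, mul_one]
    · rw [hE i j hij, mul_zero]
  conv_lhs => rw [Matrix.matrix_eq_sum_single X]
  simp only [map_sum, Matrix.trace_sum, hX]
  simp [Matrix.trace]

/-- `X ⊗ Y ↦ tr(X) Y a b`. -/
def traceEntry (a b : Fin n) : Mat ⊗[k] Mat →ₗ[k] k :=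
  TensorProduct.lift ((LinearMap.mul k k).compl₁₂ (Matrix.traceLinearMap (Fin n) k k)
    (Matrix.entryLinearMap k k a b))

theorem sum_entry2 (a b : Fin n) (z : Mat ⊗[k] Mat) :
    ∑ p, entry2 p p a b z = traceEntry a b z := by
  induction z with
  | zero => simp
  | add x y hx hy => simp only [map_add, Finset.sum_add_distrib, hx, hy]
  | tmul X Y => simp [entry2_tmul, traceEntry, Matrix.trace]

theorem traceEntry_casimir (a b : Fin n) :
    traceEntry a b (casimir k n) = if a = b then 1 else 0 := by
  simp only [casimir, map_sum, traceEntry, TensorProduct.lift.tmul, LinearMap.compl₁₂_apply,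
    Matrix.traceLinearMap_apply, LinearMap.mul_apply', Matrix.entryLinearMap_apply]
  have h : ∀ i j : Fin n, (Matrix.single j i (1 : k)).trace * Matrix.single i j (1 : k) a b =
      if i = j ∧ i = a ∧ j = b then 1 else 0 := by
    intro i j
    by_cases hij : j = i
    · subst hij
      rw [Matrix.trace_single_eq_same, one_mul, Matrix.single_apply]
      simp
    · rw [Matrix.trace_single_eq_of_ne _ _ _ hij, zero_mul, if_neg]
      exact fun h => hij h.1.symm
  simp only [h]
  rw [Finset.sum_eq_single a, Finset.sum_eq_single b]
  · simp
  · intro j _ hj; simp [hj]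
  · simp
  · intro i _ hi; simp [hi]
  · simp

/-- Tracing the first factor is invariant under `σ ⊗ 1`, which scales `γ_j` by `ε^j ≠ 1` for `0 < j
< m`; hence only `γ_0` survives, and it carries the whole partial trace of `γ`, the identity matrix.
-/
theorem sum_entry2_graded (hn : (n : k) ≠ 0) (m : ℕ) (σ : Mat ≃ₐ[k] Mat) (ε : k)
    (γs : ℕ → Mat ⊗[k] Mat) (hm : 0 < m) (hε : IsPrimitiveRoot ε m)
    (hsum : ∑ j ∈ Finset.range m, γs j = casimir k n)
    (hσ : ∀ j < m, TensorProduct.map σ.toLinearMap LinearMap.id (γs j) = ε ^ j • γs j)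
    (j : ℕ) (hj : j < m) (a b : Fin n) :
    ∑ p, entry2 p p a b (γs j) = if j = 0 ∧ a = b then 1 else 0 := by
  have hinv : ∀ z : Mat ⊗[k] Mat,
      traceEntry a b (TensorProduct.map σ.toLinearMap LinearMap.id z) = traceEntry a b z := by
    intro z
    induction z with
    | zero => simp
    | add x y hx hy => simp only [map_add, hx, hy]
    | tmul X Y => simp [traceEntry, trace_algEquiv σ hn]
  have h0 : ∀ j < m, j ≠ 0 → traceEntry a b (γs j) = 0 := by
    intro j hj hj0
    have h := hinv (γs j)
    rw [hσ j hj, map_smul, smul_eq_mul] at h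
    have h1 : (ε ^ j - 1) * traceEntry a b (γs j) = 0 := by rw [sub_mul, h, one_mul, sub_self]
    refine (mul_eq_zero.mp h1).resolve_left (sub_ne_zero.mpr ?_)
    exact hε.pow_ne_one_of_pos_of_lt hj0 hj
  rw [sum_entry2]
  by_cases hj0 : j = 0
  · have h := congrArg (traceEntry a b) hsum
    rw [map_sum, traceEntry_casimir, Finset.sum_eq_single 0] at h
    · simp [hj0, h]
    · intro i hi hi0
      exact h0 i (Finset.mem_range.mp hi) hi0
    · intro h; exact absurd (Finset.mem_range.mpr hm) h
  · rw [h0 j hj hj0, if_neg (fun h => hj0 h.1)]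

end Reduction

/-! ### The trigonometric normal form as a Laurent polynomial identity. -/

section TrigonometricReduction

variable {k : Type u} [Field k] {n : ℕ}

local notation "Mat" => Matrix (Fin n) (Fin n) k

theorem comp2_incl_mul_incl {R : Type*} [CommRing R] [Algebra k R] (p q a b : Fin n) (s s' : R)
    (X Y : Mat) :
    comp2 p q a b ((s ⊗ₜ[k] incl (k := k) 0 X) * (s' ⊗ₜ[k] incl (k := k) 1 Y)) =
      (X p q * Y a b) • (s * s') := by
  have h0 : incl (k := k) 0 X = X ⊗ₜ[k] (1 : Mat) := rfl
  have h1 : incl (k := k) 1 Y = (1 : Mat) ⊗ₜ[k] Y := rfl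
  rw [h0, h1, Algebra.TensorProduct.tmul_mul_tmul, Algebra.TensorProduct.tmul_mul_tmul, comp2_tmul,
    entry2_tmul, one_mul, mul_one]

variable [CharZero k]

theorem expSer_smul_X (c : k) (s : Fin 2) :
    expSer (c • (MvPowerSeries.X s : Ser2 k)) = (expUnit c s : (Ser2 k)ˣ) := rfl

theorem ev_expUnit_single (m : ℕ) (i j : ℤ) (c : k) :
    Laurent.ev (fun s => expUnit (1 / (m : k)) s) (AddMonoidAlgebra.single ![i, j] c) =
      c • (expSer (((i : k) / (m : k)) • (MvPowerSeries.X 0 : Ser2 k)) *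
        expSer (((j : k) / (m : k)) • (MvPowerSeries.X 1 : Ser2 k))) := by
  rw [Laurent.ev_single, Fin.prod_univ_two, expUnit_zpow, expUnit_zpow, expSer_smul_X,
    expSer_smul_X, mul_one_div, mul_one_div]
  rfl

theorem expSer_smul_diag2 (m : ℕ) (j : ℤ) :
    expSer (((j : k) / (m : k)) • diag2 k) =
      Laurent.ev (fun s => expUnit (1 / (m : k)) s) (AddMonoidAlgebra.single ![j, -j] (1 : k)) := by
  rw [ev_expUnit_single, one_smul, diag2, smul_sub, sub_eq_add_neg, expSer,
    exp_subst_add _ _ (by simp) (by simp)]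
  congr 2
  push_cast
  rw [neg_div, neg_smul]

theorem expDiag_eq (m : ℕ) (hm : 0 < m) :
    (expDiag : Ser2 k) = Laurent.ev (fun s => expUnit (1 / (m : k)) s)
      (delta m : Laurent k (Fin 2)) := by
  have h := expSer_smul_diag2 (k := k) m m
  have hm' : (m : k) ≠ 0 := by exact_mod_cast hm.ne'
  rw [Int.cast_natCast, div_self hm', one_smul] at h
  rw [expDiag, h, delta, map_sub, map_one]

theorem comp2_expEval_mul_expEval (m : ℕ) (x y : LaurentPolynomial Mat) (p q a b : Fin n) :
    comp2 p q a b ((expEval m 0 x : Tensor2 k Mat) * expEval m 1 y) ∈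
      LinearMap.range (toLoc2.toLinearMap ∘ₗ
        (Laurent.ev (fun s => expUnit (1 / (m : k)) s)).toLinearMap :
        Laurent k (Fin 2) →ₗ[k] Loc2 k) := by
  induction x using AddMonoidAlgebra.induction_linear with
  | zero => rw [map_zero, zero_mul, map_zero]; exact zero_mem _
  | add x x' hx hx' => rw [map_add, add_mul, map_add]; exact add_mem hx hx'
  | single i X =>
    induction y using AddMonoidAlgebra.induction_linear with
    | zero => rw [map_zero, mul_zero, map_zero]; exact zero_mem _
    | add y y' hy hy' => rw [map_add, mul_add, map_add]; exact add_mem hy hy'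
    | single j Y =>
      have h : ∀ (s : Fin 2) (l : ℤ) (Z : Mat), expEval (k := k) m s (AddMonoidAlgebra.single l Z) =
          toLoc2 (expSer (((l : k) / (m : k)) • (MvPowerSeries.X s : Ser2 k))) ⊗ₜ[k]
            incl (k := k) s Z := by
        intro s l Z
        change Finsupp.lsum k _ (Finsupp.single l Z) = _
        rw [Finsupp.lsum_single]
        rfl
      refine ⟨AddMonoidAlgebra.single ![i, j] (X p q * Y a b), ?_⟩
      rw [h, h, comp2_incl_mul_incl]
      change toLoc2 (Laurent.ev _ _) = _
      rw [ev_expUnit_single, map_smul, map_mul]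

theorem comp2_expEval2 (m : ℕ) (σ : Mat ≃ₐ[k] Mat) (ε : k)
    (t : loopAlgebra σ ε ⊗[k] loopAlgebra σ ε) (p q a b : Fin n) :
    ∃ D : Laurent k (Fin 2), toLoc2 (Laurent.ev (fun s => expUnit (1 / (m : k)) s) D) =
      comp2 p q a b (expEval2 m σ ε t) := by
  change comp2 p q a b (expEval2 m σ ε t) ∈ LinearMap.range (toLoc2.toLinearMap ∘ₗ
        (Laurent.ev (fun s => expUnit (1 / (m : k)) s)).toLinearMap :
        Laurent k (Fin 2) →ₗ[k] Loc2 k)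
  induction t with
  | zero => rw [map_zero, map_zero]; exact zero_mem _
  | add x y hx hy => rw [map_add, map_add]; exact add_mem hx hy
  | tmul x y => exact comp2_expEval_mul_expEval m x.1 y.1 p q a b

theorem exists_laurentCYBE_of_trigForm (m : ℕ) (hm : 0 < m) (σ : Mat ≃ₐ[k] Mat) (ε : k)
    (γs : ℕ → Mat ⊗[k] Mat) (t : loopAlgebra σ ε ⊗[k] loopAlgebra σ ε)
    (h : CYB (trigForm m σ ε γs t) = 0) :
    ∃ t' : Fin n → Fin n → Fin n → Fin n → Laurent k (Fin 2),
      LaurentCYBE m (fun p q a b => numerator m (fun j => entry2 p q a b (γs j)) (t' p q a b)) := by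
  choose t' ht' using comp2_expEval2 m σ ε t
  refine ⟨t', ?_⟩
  have hm' : (m : k) ≠ 0 := by exact_mod_cast hm.ne'
  -- With `c = 1/m` the denominator `exp(x-y) - 1` is `delta m` evaluated at the exponentials.
  refine LaurentCYBE_of_exp m (1 / (m : k)) (one_div_ne_zero hm') _ ?_
  rw [← expDiag_eq m hm]
  refine cleared_of_CYB _ h expDiag _ fun p q a b => ?_
  have hinv : toLoc2 (expDiag : Ser2 k) * Ring.inverse (toLoc2 (expDiag : Ser2 k)) = 1 :=
    Ring.mul_inverse_cancel _ isUnit_expDiag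
  rw [trigForm, map_add, map_sum, ← ht', mul_add, ← map_mul, expDiag_eq m hm, ← map_mul,
    ← expDiag_eq m hm, numerator, map_add, map_add, map_sum, map_sum, Finset.mul_sum]
  congr 1
  refine Finset.sum_congr rfl fun j _ => ?_
  have h1 : AddMonoidAlgebra.single ![(j : ℤ), -(j : ℤ)] (entry2 p q a b (γs j)) =
      entry2 p q a b (γs j) • AddMonoidAlgebra.single ![(j : ℤ), -(j : ℤ)] (1 : k) := by simp
  have h2 := expSer_smul_diag2 (k := k) m j
  rw [Int.cast_natCast] at h2
  rw [h1, map_smul, map_smul, ← h2]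
  refine (congrArg (_ * ·) (comp2_tmul p q a b _ (γs j))).trans ?_
  rw [mul_smul_comm, ← mul_assoc, hinv, one_mul]

end TrigonometricReduction

/-! ### The quasi-trigonometric normal form as a Laurent polynomial identity. -/

section QuasiReduction

variable {k : Type u} [Field k] {n : ℕ}

local notation "Mat" => Matrix (Fin n) (Fin n) k

theorem comp2_polyTensor (t : MvPolynomial (Fin 2) k ⊗[k] (Mat ⊗[k] Mat)) (p q a b : Fin n) :
    ∃ P : MvPolynomial (Fin 2) k, toLoc2 (P : Ser2 k) = comp2 p q a b (polyTensor k Mat t) := by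
  change comp2 p q a b (polyTensor k Mat t) ∈ LinearMap.range
    (toLoc2.comp (MvPolynomial.coeToMvPowerSeries.algHom k)).toLinearMap
  induction t with
  | zero => rw [map_zero, map_zero]; exact zero_mem _
  | add x y hx hy => rw [map_add, map_add]; exact add_mem hx hy
  | tmul P z =>
    refine ⟨entry2 p q a b z • P, ?_⟩
    rw [map_smul]
    exact (comp2_tmul p q a b _ z).symm

theorem subst3_coe (i j : Fin 3) (P : MvPolynomial (Fin 2) k) :
    subst3 i j (P : Ser2 k) = ((MvPolynomial.rename ![i, j] P : MvPolynomial (Fin 3) k) : Ser3 k) := by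
  have h : (subst3 i j).comp (MvPolynomial.coeToMvPowerSeries.algHom k) =
      (MvPolynomial.coeToMvPowerSeries.algHom k).comp (MvPolynomial.rename ![i, j]) := by
    apply MvPolynomial.algHom_ext
    intro s
    simp only [AlgHom.comp_apply, MvPolynomial.coeToMvPowerSeries.algHom_apply]
    simp [subst3_X]
  exact DFunLike.congr_fun h P

theorem diag2_eq_coe :
    diag2 k = ((MvPolynomial.X 0 - MvPolynomial.X 1 : MvPolynomial (Fin 2) k) : Ser2 k) := by
  have h := map_sub (MvPolynomial.coeToMvPowerSeries.ringHom (σ := Fin 2) (R := k))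
    (MvPolynomial.X 0) (MvPolynomial.X 1)
  simp only [MvPolynomial.coeToMvPowerSeries.ringHom_apply, MvPolynomial.coe_X] at h
  exact h.symm

/-- Since `y / (x - y) = 1 / (x/y - 1)`, this is the case `m = 1` with the coordinates themselves in
place of exponentials: polynomials embed in power series, so the cleared equation can be evaluated
at units directly. -/
theorem exists_laurentCYBE_of_quasiTrigForm (γ : Mat ⊗[k] Mat)
    (t : MvPolynomial (Fin 2) k ⊗[k] (Mat ⊗[k] Mat)) (h : CYB (quasiTrigForm γ t) = 0) :
    ∃ t' : Fin n → Fin n → Fin n → Fin n → Laurent k (Fin 2),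
      LaurentCYBE 1 (fun p q a b => numerator 1 (fun _ => entry2 p q a b γ) (t' p q a b)) := by
  choose P hP using comp2_polyTensor t
  let Q : Fin n → Fin n → Fin n → Fin n → MvPolynomial (Fin 2) k := fun p q a b =>
    entry2 p q a b γ • MvPolynomial.X 1 + (MvPolynomial.X 0 - MvPolynomial.X 1) * P p q a b
  have hQ : ∀ p q a b, toLoc2 (diag2 k) * comp2 p q a b (quasiTrigForm γ t) =
      toLoc2 (Q p q a b : Ser2 k) := by
    intro p q a b
    have h1 : toLoc2 (diag2 k) * IsLocalization.Away.invSelf (diag2 k) = 1 :=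
      IsLocalization.Away.mul_invSelf (diag2 k)
    have h2 : comp2 p q a b ((toLoc2 (MvPowerSeries.X 1) *
        IsLocalization.Away.invSelf (diag2 k)) ⊗ₜ[k] γ : Tensor2 k Mat) =
        entry2 p q a b γ • (toLoc2 (MvPowerSeries.X 1) *
        IsLocalization.Away.invSelf (diag2 k)) := comp2_tmul p q a b _ γ
    have h3 : (Q p q a b : Ser2 k) = entry2 p q a b γ • (MvPowerSeries.X 1 : Ser2 k) +
        diag2 k * (P p q a b : Ser2 k) := by
      rw [diag2_eq_coe]
      simp [Q, MvPolynomial.smul_eq_C_mul, MvPowerSeries.smul_eq_C_mul]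
    rw [quasiTrigForm, map_add, h2, ← hP, h3, map_add, map_smul, map_mul, mul_add, mul_smul_comm,
      mul_left_comm, h1, mul_one]
  have hcl := cleared_of_CYB _ h (diag2 k) _ hQ
  rw [diag2_eq_coe] at hcl
  simp only [subst3_coe] at hcl
  have hpoly := Cleared.of_map (MvPolynomial.coeToMvPowerSeries.ringHom (σ := Fin 3) (R := k))
    (MvPolynomial.coe_injective (Fin 3) k) hcl
  refine ⟨fun p q a b => MvPolynomial.aeval (fun i => ((Laurent.X i : (Laurent k (Fin 2))ˣ) :
    Laurent k (Fin 2))) (P p q a b), ?_⟩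
  intro R _ _ w
  -- Dividing each pair by its second variable changes the denominator `x - y` into `delta 1`.
  have h1 := (hpoly.map (MvPolynomial.aeval (fun i => (w i : R)) :
    MvPolynomial (Fin 3) k →ₐ[k] R).toRingHom).scale (fun s => ((w (sndIdx s))⁻¹ : Rˣ))
  have hren : ∀ (s : Fin 3) (f : MvPolynomial (Fin 2) k),
      MvPolynomial.aeval (fun i => (w i : R)) (MvPolynomial.rename ![fstIdx s, sndIdx s] f) =
      MvPolynomial.aeval ![(w (fstIdx s) : R), (w (sndIdx s) : R)] f := by
    intro s f
    rw [MvPolynomial.aeval_rename]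
    congr 2
    funext i
    fin_cases i <;> rfl
  have hev : ∀ (s : Fin 3) (f : MvPolynomial (Fin 2) k), Laurent.ev ![w (fstIdx s), w (sndIdx s)]
      (MvPolynomial.aeval (fun i => ((Laurent.X i : (Laurent k (Fin 2))ˣ) : Laurent k (Fin 2))) f) =
      MvPolynomial.aeval ![(w (fstIdx s) : R), (w (sndIdx s) : R)] f := by
    intro s f
    rw [← AlgHom.comp_apply, MvPolynomial.comp_aeval]
    congr 2
    funext i
    refine (congrArg Units.val (Laurent.map_X ![w (fstIdx s), w (sndIdx s)] i)).trans ?_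
    fin_cases i <;> rfl
  have hdelta : ∀ s : Fin 3, Laurent.ev ![w (fstIdx s), w (sndIdx s)]
      (delta 1 : Laurent k (Fin 2)) =
      ((w (sndIdx s))⁻¹ : Rˣ) * ((w (fstIdx s) : R) - w (sndIdx s)) := by
    intro s
    rw [delta, map_sub, map_one, Laurent.ev_single, one_smul, Fin.prod_univ_two, mul_sub,
      Units.inv_mul]
    simp [mul_comm]
  have hnum : ∀ (s : Fin 3) p q a b, Laurent.ev ![w (fstIdx s), w (sndIdx s)]
      (numerator 1 (fun _ => entry2 p q a b γ) (MvPolynomial.aeval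
        (fun i => ((Laurent.X i : (Laurent k (Fin 2))ˣ) : Laurent k (Fin 2))) (P p q a b))) =
      ((w (sndIdx s))⁻¹ : Rˣ) *
        MvPolynomial.aeval ![(w (fstIdx s) : R), (w (sndIdx s) : R)] (Q p q a b) := by
    intro s p q a b
    simp only [numerator, Finset.sum_range_one, map_add, map_mul, hdelta, hev, Q, map_smul,
      map_sub, MvPolynomial.aeval_X, Laurent.ev_single, mul_add, mul_smul_comm]
    simp [mul_assoc]
  simp only [hnum, hdelta]
  change Cleared (fun s p q a b => _ * MvPolynomial.aeval _ (MvPolynomial.rename _ _))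
    (fun s => _ * MvPolynomial.aeval _ (MvPolynomial.rename _ _)) at h1
  simp only [hren, map_sub, MvPolynomial.aeval_X] at h1
  exact h1

end QuasiReduction

/-! ### Recovering a trace from the traces of higher powers. -/

section TracePowers

open Polynomial

/-- Multiplying the Bézout relation by `X` gives `X - α X³ = X β u`. The power `(X β u)^(a+1)` is
divisible by `X^a u`, which kills `A`, so `A - α(A) A³` is nilpotent and has trace zero. -/
theorem trace_eq_trace_aeval {K : Type*} [Field K] {m : Type*} [Fintype m] [DecidableEq m]
    (A : Matrix m m K) (a : ℕ) (α β u : K[X]) (hαβ : α * X ^ 2 + β * u = 1)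
    (hA : aeval A (X ^ a * u) = 0) :
    A.trace = α.sum fun i c => c * (A ^ (i + 3)).trace := by
  have h1 : (X : K[X]) - α * X ^ 3 = X * β * u := by linear_combination (-X) * hαβ
  have hnil : IsNilpotent (aeval A ((X : K[X]) - α * X ^ 3)) := by
    refine ⟨a + 1, ?_⟩
    rw [← map_pow, h1]
    have h2 : ((X : K[X]) * β * u) ^ (a + 1) = (X * β ^ (a + 1) * u ^ a) * (X ^ a * u) := by ring
    rw [h2, map_mul, hA, mul_zero]
  have h2 := (Matrix.isNilpotent_trace_of_isNilpotent hnil).eq_zero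
  rw [map_sub, aeval_X, Matrix.trace_sub, sub_eq_zero] at h2
  rw [h2, map_mul, map_pow, aeval_X, aeval_eq_sum_range, Finset.sum_mul, Matrix.trace_sum,
    sum_over_range _ (by simp)]
  refine Finset.sum_congr rfl fun i _ => ?_
  rw [smul_mul_assoc, Matrix.trace_smul, ← pow_add, smul_eq_mul]

/-- If the traces of all powers from the square on agree, then the traces agree. -/
theorem trace_eq_of_trace_pow_eq {K : Type*} [Field K] {m m' : Type*} [Fintype m] [DecidableEq m]
    [Fintype m'] [DecidableEq m'] (M : Matrix m m K) (M' : Matrix m' m' K)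
    (h : ∀ l, 2 ≤ l → (M ^ l).trace = (M' ^ l).trace) : M.trace = M'.trace := by
  -- A common annihilating polynomial, so that the same `α` and `β` serve both matrices, whatever
  -- their sizes.
  have hq0 : M.charpoly * M'.charpoly ≠ 0 :=
    mul_ne_zero M.charpoly_monic.ne_zero M'.charpoly_monic.ne_zero
  obtain ⟨u, hu, hnd⟩ := exists_eq_pow_rootMultiplicity_mul_and_not_dvd _ hq0 0
  rw [C_0, sub_zero] at hu hnd
  obtain ⟨α, β, hαβ⟩ : IsCoprime ((X : K[X]) ^ 2) u :=
    IsCoprime.pow_left ((irreducible_X (R := K)).coprime_iff_not_dvd.mpr hnd)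
  have hM : aeval M (M.charpoly * M'.charpoly) = 0 := by
    rw [map_mul, Matrix.aeval_self_charpoly, zero_mul]
  have hM' : aeval M' (M.charpoly * M'.charpoly) = 0 := by
    rw [map_mul, Matrix.aeval_self_charpoly, mul_zero]
  rw [hu] at hM hM'
  rw [trace_eq_trace_aeval M _ α β u hαβ hM, trace_eq_trace_aeval M' _ α β u hαβ hM']
  exact Finset.sum_congr rfl fun i _ => congrArg (α.coeff i * ·) (h (i + 3) (by omega))

end TracePowers

/-! ### Lattices over `k⟦s⟧` stable under a matrix with bounded powers. -/

section Lattice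

variable {k : Type u} [Field k]

theorem eq_single_mul_ofPowerSeries (x : LaurentSeries k) (N : ℕ)
    (hx : ∀ j : ℤ, j < -N → x.coeff j = 0) :
    x = HahnSeries.single (-N : ℤ) 1 *
      HahnSeries.ofPowerSeries ℤ k (PowerSeries.mk fun j => x.coeff (j - N)) := by
  ext j
  obtain ⟨i, rfl⟩ : ∃ i : ℤ, j = i + -N := ⟨j + N, by ring⟩
  rw [HahnSeries.coeff_single_mul_add, one_mul]
  by_cases hi : 0 ≤ i
  · obtain ⟨l, rfl⟩ := Int.eq_ofNat_of_zero_le hi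
    rw [HahnSeries.ofPowerSeries_apply_coeff, PowerSeries.coeff_mk]
    rfl
  · rw [hx _ (by omega), HahnSeries.ofPowerSeries_apply]
    symm
    apply HahnSeries.embDomain_of_notMem_range
    rintro ⟨l, hl⟩
    simp at hl
    omega

/-- A matrix over `k((s))` all of whose powers have pole order at most `N` is conjugate to a matrix
over `k⟦s⟧`, so that the constant terms of the traces of its powers are the traces of the powers
of a matrix over `k`. -/
theorem exists_matrix_trace_pow_eq {n : ℕ} (g : Matrix (Fin n) (Fin n) (LaurentSeries k)) (N : ℕ)
    (hg : ∀ l p q, ∀ j : ℤ, j < -N → ((g ^ l) p q).coeff j = 0) :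
    ∃ (d : ℕ) (M : Matrix (Fin d) (Fin d) k), ∀ l,
      ((g ^ l).trace).coeff 0 = (M ^ l).trace := by
  -- The columns of all powers of `g` span a `g`-stable module. The pole bound puts it inside
  -- `s^(-N) k⟦s⟧ⁿ`, so it is finitely generated; the columns of `g ^ 0` show that it spans the
  -- whole space.
  let Λ : Submodule (PowerSeries k) (Fin n → LaurentSeries k) :=
    Submodule.span _ (Set.range fun x : ℕ × Fin n => (g ^ x.1).col x.2)
  let ψ : (Fin n → PowerSeries k) →ₗ[PowerSeries k] (Fin n → LaurentSeries k) :=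
    LinearMap.pi fun i => (LinearMap.mulLeft (PowerSeries k)
      (HahnSeries.single (-N : ℤ) 1 : LaurentSeries k)) ∘ₗ
        (Algebra.linearMap (PowerSeries k) (LaurentSeries k)) ∘ₗ LinearMap.proj i
  have hΛψ : Λ ≤ LinearMap.range ψ := by
    rw [Submodule.span_le]
    rintro _ ⟨⟨l, q⟩, rfl⟩
    refine ⟨fun p => PowerSeries.mk fun j => ((g ^ l) p q).coeff (j - N), ?_⟩
    funext p
    exact (eq_single_mul_ofPowerSeries _ N (hg l p q)).symm
  have hfg : Λ.FG := by
    have hN : IsNoetherian (PowerSeries k) (LinearMap.range ψ) :=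
      isNoetherian_of_isNoetherianRing_of_finite _ _
    have := isNoetherian_of_le hΛψ
    exact Module.Finite.iff_fg.mp inferInstance
  have htop : Submodule.span (LaurentSeries k) (Λ : Set (Fin n → LaurentSeries k)) = ⊤ := by
    rw [eq_top_iff, ← (Pi.basisFun (LaurentSeries k) (Fin n)).span_eq]
    refine Submodule.span_mono ?_
    rintro _ ⟨q, rfl⟩
    refine Submodule.subset_span ⟨(0, q), ?_⟩
    funext p
    simp [Matrix.one_apply, Pi.single_apply]
  have : Submodule.IsLattice (LaurentSeries k) Λ := ⟨hfg, htop⟩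
  have hmap : ∀ v ∈ Λ, (Matrix.toLin' g).restrictScalars (PowerSeries k) v ∈ Λ := by
    intro v hv
    refine Submodule.span_induction (p := fun v _ =>
      (Matrix.toLin' g).restrictScalars (PowerSeries k) v ∈ Λ) ?_ ?_ ?_ ?_ hv
    · rintro _ ⟨⟨l, q⟩, rfl⟩
      refine Submodule.subset_span ⟨(l + 1, q), ?_⟩
      funext p
      change (g ^ (l + 1)) p q = (g.mulVec ((g ^ l).col q)) p
      rw [pow_succ']
      rfl
    · rw [map_zero]; exact zero_mem _
    · intro x y _ _ hx hy; rw [map_add]; exact add_mem hx hy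
    · intro c x _ hx; rw [map_smul]; exact Λ.smul_mem c hx
  let φ : Λ →ₗ[PowerSeries k] Λ :=
    ((Matrix.toLin' g).restrictScalars (PowerSeries k)).restrict hmap
  -- The lattice is free, and a basis of it is also a basis over `k((s))`; in that basis `g` has the
  -- integral matrix `G`, which is then reduced modulo `s`.
  let b := Module.finBasis (PowerSeries k) Λ
  let B := b.extendOfIsLattice (LaurentSeries k)
  obtain ⟨G, hGdef⟩ : ∃ G, G = LinearMap.toMatrix b b φ := ⟨_, rfl⟩
  have hG : LinearMap.toMatrix B B (Matrix.toLin' g) =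
      G.map (algebraMap (PowerSeries k) (LaurentSeries k)) := by
    ext1 i j
    rw [LinearMap.toMatrix_apply, Matrix.map_apply, hGdef, LinearMap.toMatrix_apply]
    have h1 : Matrix.toLin' g (B j) = (φ (b j)).val := by
      rw [Module.Basis.extendOfIsLattice_apply]; rfl
    have h2 : (φ (b j)).val = ∑ i, algebraMap (PowerSeries k) (LaurentSeries k)
        (b.repr (φ (b j)) i) • B i := by
      conv_lhs => rw [← b.sum_repr (φ (b j))]
      rw [Submodule.coe_sum]
      refine Finset.sum_congr rfl fun i _ => ?_
      rw [Module.Basis.extendOfIsLattice_apply, algebraMap_smul]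
      rfl
    rw [h1, h2, Module.Basis.repr_sum_self]
  refine ⟨_, G.map (PowerSeries.constantCoeff (R := k)), fun l => ?_⟩
  have h1 : (g ^ l).trace = algebraMap (PowerSeries k) (LaurentSeries k) (G ^ l).trace := by
    have h2 : (g ^ l).trace = LinearMap.trace (LaurentSeries k) _ (Matrix.toLin' g ^ l) := by
      rw [← Matrix.toLin'_pow, Matrix.trace_toLin'_eq]
    rw [h2, LinearMap.trace_eq_matrix_trace _ B, ← LinearMap.toMatrix_pow, hG,
      ← RingHom.mapMatrix_apply,
      ← map_pow, RingHom.mapMatrix_apply, AddMonoidHom.map_trace]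
  have h3 : ((G.map (PowerSeries.constantCoeff (R := k))) ^ l).trace =
      PowerSeries.constantCoeff (G ^ l).trace := by
    rw [← RingHom.mapMatrix_apply, ← map_pow, RingHom.mapMatrix_apply, AddMonoidHom.map_trace]
  rw [h1, h3]
  refine (HahnSeries.ofPowerSeries_apply_coeff (Γ := ℤ) _ 0).trans ?_
  exact PowerSeries.coeff_zero_eq_constantCoeff_apply _

end Lattice

/-! ### Laurent series under change of coefficients, and products of families. -/

section HahnMap

variable {S T : Type*} [CommRing S] [CommRing T]

/-- Coefficientwise application of a ring homomorphism to Laurent series. -/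
def laurentMap (f : S →+* T) : LaurentSeries S →+* LaurentSeries T where
  toFun x := x.map f
  map_zero' := by ext; simp
  map_one' := by
    ext j
    simp only [HahnSeries.map_coeff, HahnSeries.coeff_one]
    split_ifs <;> simp
  map_add' x y := by ext; simp
  map_mul' x y := HahnSeries.map_mul (f : S →ₙ+* T)

theorem laurentMap_coeff (f : S →+* T) (x : LaurentSeries S) (j : ℤ) :
    (laurentMap f x).coeff j = f (x.coeff j) := rfl

end HahnMap

section Closure

variable {S V : Type*} [CommRing S] [IsDomain S] [Ring V] [Algebra S V] {ι : Type*}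

/-- If products of two members of different families `f i`, `f j` lie in the span of `f i` and
`f j`, up to a nonzero scalar, then so do products of several members of different families. -/
theorem exists_smul_prod_mem_span (f : ℕ → ι → V)
    (hf : ∀ i j, i < j → ∀ α β, ∃ c : S, c ≠ 0 ∧
      c • (f j β * f i α) ∈ Submodule.span S (Set.range (f i) ∪ Set.range (f j))) (α : ι) (l : ℕ) :
    ∃ c : S, c ≠ 0 ∧ c • ((List.range (l + 1)).reverse.map fun i => f i α).prod ∈
      Submodule.span S (⋃ i ∈ Set.Iic l, Set.range (f i)) := by
  induction l with
  | zero =>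
    refine ⟨1, one_ne_zero, ?_⟩
    rw [one_smul]
    refine Submodule.subset_span (Set.mem_biUnion (Set.mem_Iic.mpr le_rfl) ⟨α, ?_⟩)
    simp
  | succ l ih =>
    obtain ⟨c, hc, hmem⟩ := ih
    -- The new factor has index `l + 1`, larger than every index occurring in `x`, so the rule for
    -- different families applies to each generator. Scalars of different summands are multiplied
    -- together.
    have key : ∀ x ∈ Submodule.span S (⋃ i ∈ Set.Iic l, Set.range (f i)), ∃ c : S, c ≠ 0 ∧
        c • (f (l + 1) α * x) ∈ Submodule.span S (⋃ i ∈ Set.Iic (l + 1), Set.range (f i)) := by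
      intro x hx
      induction hx using Submodule.span_induction with
      | mem x hx =>
        simp only [Set.mem_iUnion, Set.mem_Iic, Set.mem_range] at hx
        obtain ⟨i, hi, β, rfl⟩ := hx
        obtain ⟨c, hc, h⟩ := hf i (l + 1) (by omega) β α
        refine ⟨c, hc, Submodule.span_mono ?_ h⟩
        refine Set.union_subset ?_ ?_
        · exact Set.subset_biUnion_of_mem (u := fun i => Set.range (f i))
            (Set.mem_Iic.mpr (by omega : i ≤ l + 1))
        · exact Set.subset_biUnion_of_mem (u := fun i => Set.range (f i))
            (Set.mem_Iic.mpr le_rfl)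
      | zero => exact ⟨1, one_ne_zero, by rw [mul_zero, smul_zero]; exact zero_mem _⟩
      | add x y _ _ hx hy =>
        obtain ⟨c, hc, hx⟩ := hx
        obtain ⟨d, hd, hy⟩ := hy
        refine ⟨c * d, mul_ne_zero hc hd, ?_⟩
        rw [mul_add, smul_add]
        refine add_mem ?_ ?_
        · rw [mul_comm, mul_smul]; exact Submodule.smul_mem _ _ hx
        · rw [mul_smul]; exact Submodule.smul_mem _ _ hy
      | smul s x _ hx =>
        obtain ⟨c, hc, hx⟩ := hx
        refine ⟨c, hc, ?_⟩
        rw [mul_smul_comm, smul_comm]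
        exact Submodule.smul_mem _ _ hx
    obtain ⟨d, hd, h⟩ := key _ hmem
    refine ⟨d * c, mul_ne_zero hd hc, ?_⟩
    rw [mul_smul_comm, ← mul_smul] at h
    rw [List.range_succ, List.reverse_append, List.reverse_singleton, List.singleton_append,
      List.map_cons, List.prod_cons]
    exact h

end Closure

/-! ### Expansions of Laurent polynomials at `0` and at `∞`. -/

section Points

variable {k : Type u} [Field k] {S : Type u} [CommRing S] [Algebra k S]

/-- Laurent series as an algebra over the ground ring of their coefficients. -/
instance laurentSeriesAlgebra {R : Type*} [CommSemiring R] [Algebra R S] :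
    Algebra R (LaurentSeries S) := HahnSeries.instAlgebra

variable (k S) in
/-- The inclusion of the constants. -/
def constHom : S →ₐ[k] LaurentSeries S where
  __ := (HahnSeries.C : S →+* LaurentSeries S)
  commutes' _ := rfl

/-- The unit `s ^ e` of `S((s))`. -/
def param (S : Type u) [CommRing S] (e : ℤ) : (LaurentSeries S)ˣ where
  val := HahnSeries.single e 1
  inv := HahnSeries.single (-e) 1
  val_inv := by rw [HahnSeries.single_mul_single]; simp
  inv_val := by rw [HahnSeries.single_mul_single]; simp

/-- A unit of `S` as a unit of `S((s))`. -/
def constUnit (c : Sˣ) : (LaurentSeries S)ˣ := Units.map (HahnSeries.C : S →+* LaurentSeries S) c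

theorem param_zpow (e j : ℤ) : param S e ^ j = param S (e * j) := by
  have h : ∀ a b, param S a * param S b = param S (a + b) := by
    intro a b
    ext1
    change HahnSeries.single a (1 : S) * HahnSeries.single b 1 = HahnSeries.single (a + b) 1
    rw [HahnSeries.single_mul_single, one_mul]
  have h0 : param S 0 = 1 := rfl
  have hn : ∀ a, (param S a)⁻¹ = param S (-a) := by
    intro a
    rw [inv_eq_iff_mul_eq_one, h, add_neg_cancel, h0]
  have hp : ∀ l : ℕ, param S e ^ l = param S (e * l) := by
    intro l
    induction l with
    | zero => simp [h0]
    | succ l ih => rw [pow_succ, ih, h]; congr 1; push_cast; ring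
  cases j with
  | ofNat l => simpa using hp l
  | negSucc l => rw [zpow_negSucc, hp, hn]; congr 1; rw [Int.negSucc_eq]; push_cast; ring

theorem ev_param_single (e : ℤ) (c : Sˣ) (g : Fin 2 → ℤ) (x : k) :
    Laurent.ev ![param S e, constUnit c] (AddMonoidAlgebra.single g x) =
      HahnSeries.single (e * g 0) (x • ((c ^ g 1 : Sˣ) : S)) := by
  rw [Laurent.ev_single, Fin.prod_univ_two]
  change x • ((param S e ^ g 0 * constUnit c ^ g 1 : (LaurentSeries S)ˣ) : LaurentSeries S) = _
  rw [param_zpow, constUnit, ← map_zpow, Units.val_mul]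
  change x • (HahnSeries.single (e * g 0) (1 : S) * HahnSeries.C ((c ^ g 1 : Sˣ) : S)) = _
  rw [HahnSeries.C_apply, HahnSeries.single_mul_single, add_zero, one_mul]
  ext j
  rw [HahnSeries.coeff_smul]
  simp only [HahnSeries.coeff_single]
  split_ifs <;> simp

theorem coeff_ofPowerSeries_of_neg (d : PowerSeries S) (j : ℤ) (hj : j < 0) :
    (HahnSeries.ofPowerSeries ℤ S d).coeff j = 0 := by
  rw [HahnSeries.ofPowerSeries_apply]
  apply HahnSeries.embDomain_of_notMem_range
  rintro ⟨l, hl⟩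
  simp at hl
  omega

theorem coeff_zero_ofPowerSeries (d : PowerSeries S) :
    (HahnSeries.ofPowerSeries ℤ S d).coeff 0 = PowerSeries.constantCoeff d :=
  (HahnSeries.ofPowerSeries_apply_coeff (Γ := ℤ) _ 0).trans
    (PowerSeries.coeff_zero_eq_constantCoeff_apply _)

/-- The constant terms of the expansions at `0` and at `∞` of a Laurent polynomial agree. -/
theorem coeff_zero_ev_param (e : ℤ) (he : e ≠ 0) (c : Sˣ) (T : Laurent k (Fin 2)) :
    (Laurent.ev ![param S e, constUnit c] T).coeff 0 =
      (Laurent.ev ![param S 1, constUnit c] T).coeff 0 := by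
  induction T using AddMonoidAlgebra.induction_linear with
  | zero => simp only [map_zero]
  | add x y hx hy => simp only [map_add, HahnSeries.coeff_add, hx, hy]
  | single g x =>
    rw [ev_param_single, ev_param_single]
    simp [HahnSeries.coeff_single, he, eq_comm]

/-- Pole orders are bounded independently of the constants. -/
theorem exists_pole_bound (e : ℤ) (T : Laurent k (Fin 2)) :
    ∃ N : ℕ, ∀ (c : Sˣ) (d : PowerSeries S) (j : ℤ), j < -N →
      (Laurent.ev ![param S e, constUnit c] T * HahnSeries.ofPowerSeries ℤ S d).coeff j = 0 := by
  induction T using AddMonoidAlgebra.induction_linear with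
  | zero => exact ⟨0, fun c d j _ => by simp⟩
  | add x y hx hy =>
    obtain ⟨N, hN⟩ := hx
    obtain ⟨N', hN'⟩ := hy
    refine ⟨max N N', fun c d j hj => ?_⟩
    rw [map_add, add_mul, HahnSeries.coeff_add, hN c d j (by omega), hN' c d j (by omega),
      add_zero]
  | single g x =>
    refine ⟨(e * g 0).natAbs, fun c d j hj => ?_⟩
    rw [ev_param_single, HahnSeries.coeff_single_mul, coeff_ofPowerSeries_of_neg, mul_zero]
    omega

theorem ev_param_delta (e : ℤ) (c : Sˣ) (m : ℕ) :
    Laurent.ev ![param S e, constUnit c] (delta m : Laurent k (Fin 2)) =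
      HahnSeries.single (e * m) ((c ^ (-m : ℤ) : Sˣ) : S) - 1 := by
  rw [delta, map_sub, map_one, ev_param_single, one_smul]
  rfl

theorem exists_geometric (m : ℕ) (hm : 0 < m) (a : S) :
    ∃ d : PowerSeries S, (1 - HahnSeries.single (m : ℤ) a) * HahnSeries.ofPowerSeries ℤ S d = 1 ∧
      PowerSeries.constantCoeff d = 1 := by
  set φ : PowerSeries S := 1 - PowerSeries.C a * PowerSeries.X ^ m with hφ
  have h0 : PowerSeries.constantCoeff φ = ((1 : Sˣ) : S) := by simp [hφ, hm.ne']
  refine ⟨φ.invOfUnit 1, ?_, by simp [PowerSeries.constantCoeff_invOfUnit]⟩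
  have h1 : (1 : LaurentSeries S) - HahnSeries.single (m : ℤ) a =
      HahnSeries.ofPowerSeries ℤ S φ := by
    rw [hφ, map_sub, map_one, map_mul, HahnSeries.ofPowerSeries_C, HahnSeries.ofPowerSeries_X_pow,
      HahnSeries.C_apply, HahnSeries.single_mul_single, zero_add, mul_one]
  rw [h1, ← map_mul, PowerSeries.mul_invOfUnit _ _ h0, map_one]

theorem exists_inverse_delta_zero (m : ℕ) (hm : 0 < m) (c : Sˣ) :
    ∃ d : PowerSeries S, Laurent.ev ![param S 1, constUnit c] (delta m : Laurent k (Fin 2)) *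
      HahnSeries.ofPowerSeries ℤ S d = 1 ∧ PowerSeries.constantCoeff d = -1 := by
  obtain ⟨d, hd, hd0⟩ := exists_geometric m hm ((c ^ (-m : ℤ) : Sˣ) : S)
  refine ⟨-d, ?_, by rw [map_neg, hd0]⟩
  rw [ev_param_delta, one_mul, map_neg]
  linear_combination hd

/-- At `x = s⁻¹` the expansion of `1 / (x^m c^(-m) - 1)` is `c^m s^m / (1 - c^m s^m)`, without
constant term, whereas at `x = s` it starts with `-1`. This gap of `1` is the source of the
contradiction. -/
theorem exists_inverse_delta_infty (m : ℕ) (hm : 0 < m) (c : Sˣ) :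
    ∃ d : PowerSeries S, Laurent.ev ![param S (-1), constUnit c] (delta m : Laurent k (Fin 2)) *
      HahnSeries.ofPowerSeries ℤ S d = 1 ∧ PowerSeries.constantCoeff d = 0 := by
  obtain ⟨d, hd, -⟩ := exists_geometric m hm ((c ^ (m : ℤ) : Sˣ) : S)
  refine ⟨PowerSeries.C ((c ^ (m : ℤ) : Sˣ) : S) * PowerSeries.X ^ m * d, ?_, by simp [hm.ne']⟩
  have h1 : HahnSeries.single (-1 * (m : ℤ)) ((c ^ (-m : ℤ) : Sˣ) : S) *
      HahnSeries.single (m : ℤ) ((c ^ (m : ℤ) : Sˣ) : S) = 1 := by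
    rw [HahnSeries.single_mul_single, ← Units.val_mul, ← zpow_add]
    simp
  rw [ev_param_delta, map_mul, map_mul, HahnSeries.ofPowerSeries_C, HahnSeries.ofPowerSeries_X_pow,
    HahnSeries.C_apply, HahnSeries.single_mul_single, zero_add, mul_one]
  linear_combination HahnSeries.ofPowerSeries ℤ S d * h1 + hd

theorem ev_constUnit (c c' : Sˣ) (D : Laurent k (Fin 2)) :
    Laurent.ev ![constUnit c, constUnit c'] D =
      HahnSeries.C (Laurent.ev ![c, c'] D) := by
  change _ = constHom k S (Laurent.ev ![c, c'] D)
  rw [Laurent.map_ev]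
  congr 2
  funext i
  fin_cases i <;> rfl

theorem laurentMap_ev_param {T : Type u} [CommRing T] [Algebra k T] (φ : S →ₐ[k] T) (e : ℤ)
    (c : Sˣ) (D : Laurent k (Fin 2)) :
    laurentMap φ.toRingHom (Laurent.ev ![param S e, constUnit c] D) =
      Laurent.ev ![param T e, constUnit (Units.map (φ : S →* T) c)] D := by
  induction D using AddMonoidAlgebra.induction_linear with
  | zero => simp only [map_zero]
  | add x y hx hy => simp only [map_add, hx, hy]
  | single g x =>
    rw [ev_param_single, ev_param_single, ← map_zpow]
    ext j
    rw [laurentMap_coeff]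
    simp only [HahnSeries.coeff_single]
    split_ifs
    · exact map_smul φ _ _
    · exact map_zero φ

end Points

/-! ### Slices of a solution and their multiplication rule. -/

section Core

variable {k : Type u} [Field k] {n : ℕ} {S : Type u} [CommRing S] [Algebra k S]

/-- The matrices over `S((s))` obtained from `D / delta m` at `(s ^ e, c)`, where `d` is the
expansion of `1 / delta m`. -/
def slice (D : Fin n → Fin n → Fin n → Fin n → Laurent k (Fin 2)) (e : ℤ) (d : PowerSeries S)
    (c : Sˣ) (α : Fin n × Fin n) : Matrix (Fin n) (Fin n) (LaurentSeries S) :=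
  Matrix.of fun p q => Laurent.ev ![param S e, constUnit c] (D p q α.1 α.2) *
    HahnSeries.ofPowerSeries ℤ S d

variable {m : ℕ} {D : Fin n → Fin n → Fin n → Fin n → Laurent k (Fin 2)}

/-- The equation at `(s^e, c, c')`, read in the first tensor factor and multiplied by `d d'`. The
term `r¹³ r¹²` gives the product of slices; in the other two terms `r²³(c,c')` is free of `s` and
contributes only scalars. -/
theorem slice_mul_slice (hD : LaurentCYBE m D) (e : ℤ) (d d' : PowerSeries S) (c c' : Sˣ)
    (hd : Laurent.ev ![param S e, constUnit c] (delta m : Laurent k (Fin 2)) *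
      HahnSeries.ofPowerSeries ℤ S d = 1)
    (hd' : Laurent.ev ![param S e, constUnit c'] (delta m : Laurent k (Fin 2)) *
      HahnSeries.ofPowerSeries ℤ S d' = 1) (α β : Fin n × Fin n) :
    Laurent.ev ![c, c'] (delta m : Laurent k (Fin 2)) •
        (slice D e d' c' β * slice D e d c α) =
      ∑ o, Laurent.ev ![c, c'] (D o α.2 β.1 β.2) • slice D e d c (α.1, o) -
      ∑ o, Laurent.ev ![c, c'] (D α.1 α.2 β.1 o) • slice D e d' c' (o, β.2) := by
  ext1 p q
  have h := hD (LaurentSeries S) ![param S e, constUnit c, constUnit c'] p q α.1 α.2 β.1 β.2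
  simp only [fstIdx, sndIdx, Matrix.cons_val_zero, Matrix.cons_val_one, Matrix.cons_val,
    ev_constUnit] at h
  simp only [slice, Matrix.smul_apply, Matrix.sub_apply, Matrix.sum_apply, Matrix.mul_apply,
    Matrix.of_apply, ← HahnSeries.C_mul_eq_smul]
  generalize HahnSeries.ofPowerSeries ℤ S d = x at *
  generalize HahnSeries.ofPowerSeries ℤ S d' = x' at *
  generalize Laurent.ev ![param S e, constUnit c] (delta m : Laurent k (Fin 2)) = y at *
  generalize Laurent.ev ![param S e, constUnit c'] (delta m : Laurent k (Fin 2)) = y' at *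
  have h1 := congrArg (x * x' * ·) h
  simp only [mul_zero, mul_add, mul_sub, Finset.mul_sum] at h1
  rw [← sub_eq_zero, Finset.mul_sum, ← h1, sub_sub_eq_add_sub, add_sub_right_comm]
  congr 1
  · congr 1
    · exact Finset.sum_congr rfl fun o _ => by ring
    · refine Finset.sum_congr rfl fun o _ => ?_
      linear_combination (-HahnSeries.C (Laurent.ev ![c, c'] (D o α.2 β.1 β.2)) *
        Laurent.ev ![param S e, constUnit c] (D p q α.1 o) * x) * hd'
  · refine Finset.sum_congr rfl fun o _ => ?_
    linear_combination (-HahnSeries.C (Laurent.ev ![c, c'] (D α.1 α.2 β.1 o)) *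
      Laurent.ev ![param S e, constUnit c'] (D p q o β.2) * x') * hd

variable {g : ℕ → Fin n → Fin n → Fin n → Fin n → k}
  {t : Fin n → Fin n → Fin n → Fin n → Laurent k (Fin 2)}

/-- By `htr` the traced pole part reduces to `δ_{ab} / delta m`. The remaining Laurent polynomial
contributes the same constant term at `0` and at `∞`, so it will cancel in `traceDiff`. -/
theorem coeff_zero_trace_slice (hm : 0 < m)
    (htr : ∀ j < m, ∀ a b, ∑ p, g j p p a b = if j = 0 ∧ a = b then 1 else 0)
    (e : ℤ) (d : PowerSeries S) (c : Sˣ)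
    (hd : Laurent.ev ![param S e, constUnit c] (delta m : Laurent k (Fin 2)) *
      HahnSeries.ofPowerSeries ℤ S d = 1) (α : Fin n × Fin n) :
    ((slice (fun p q a b => numerator m (fun j => g j p q a b) (t p q a b)) e d c α).trace).coeff 0
      = (if α.1 = α.2 then PowerSeries.constantCoeff d else 0) +
        (Laurent.ev ![param S e, constUnit c] (∑ p, t p p α.1 α.2)).coeff 0 := by
  have h1 : ∑ p, numerator m (fun j => g j p p α.1 α.2) (t p p α.1 α.2) =
      (if α.1 = α.2 then 1 else 0) + delta m * ∑ p, t p p α.1 α.2 := by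
    simp only [numerator, Finset.sum_add_distrib, ← Finset.mul_sum]
    congr 1
    have hs : ∀ j : ℕ, ∑ p, (AddMonoidAlgebra.single ![(j : ℤ), -(j : ℤ)] (g j p p α.1 α.2) :
        Laurent k (Fin 2)) = AddMonoidAlgebra.single ![(j : ℤ), -(j : ℤ)]
          (∑ p, g j p p α.1 α.2) := fun j =>
      (map_sum (AddMonoidAlgebra.singleAddHom (R := k) ![(j : ℤ), -(j : ℤ)]) _ _).symm
    rw [Finset.sum_comm, Finset.sum_eq_single_of_mem 0 (Finset.mem_range.mpr hm)]
    · rw [hs, htr 0 hm]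
      have h0 : ![((0 : ℕ) : ℤ), -((0 : ℕ) : ℤ)] = 0 := by simp
      rw [h0]
      simp only [true_and]
      split_ifs
      · rfl
      · exact AddMonoidAlgebra.single_zero _
    · intro j hj hj0
      rw [hs, htr j (Finset.mem_range.mp hj)]
      simp [hj0]
  simp only [Matrix.trace, slice, Matrix.diag_apply, Matrix.of_apply]
  rw [← Finset.sum_mul, ← map_sum, h1, map_add, map_mul, add_mul, mul_right_comm, hd, one_mul,
    HahnSeries.coeff_add]
  congr 1
  split_ifs
  · rw [map_one, one_mul, coeff_zero_ofPowerSeries]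
  · rw [map_zero, zero_mul, HahnSeries.coeff_zero]

/-- The series `d` and `d'` are inverses of evaluations of `delta m` that become equal under `φ`, so
by uniqueness of inverses their images agree as well. -/
theorem laurentMap_slice {T : Type u} [CommRing T] [Algebra k T] (φ : S →ₐ[k] T) (e : ℤ)
    (d d' : PowerSeries S) (c c' : Sˣ)
    (hd : Laurent.ev ![param S e, constUnit c] (delta m : Laurent k (Fin 2)) *
      HahnSeries.ofPowerSeries ℤ S d = 1)
    (hd' : Laurent.ev ![param S e, constUnit c'] (delta m : Laurent k (Fin 2)) *
      HahnSeries.ofPowerSeries ℤ S d' = 1)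
    (hc : Units.map (φ : S →* T) c = Units.map (φ : S →* T) c') (α : Fin n × Fin n) :
    (slice D e d c α).map (laurentMap φ.toRingHom) =
      (slice D e d' c' α).map (laurentMap φ.toRingHom) := by
  have h1 := congrArg (laurentMap φ.toRingHom) hd
  have h2 := congrArg (laurentMap φ.toRingHom) hd'
  rw [map_mul, map_one, laurentMap_ev_param, hc] at h1
  rw [map_mul, map_one, laurentMap_ev_param, mul_comm] at h2
  have h3 := left_inv_eq_right_inv h2 h1
  ext1 p q
  simp only [slice, Matrix.map_apply, Matrix.of_apply, map_mul, laurentMap_ev_param, hc, h3]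

/-- What matters is that `N` is chosen before `d` and `c`: one bound serves the slices at all
points, hence also everything in their span. -/
theorem exists_slice_pole_bound (D : Fin n → Fin n → Fin n → Fin n → Laurent k (Fin 2)) (e : ℤ) :
    ∃ N : ℕ, ∀ (d : PowerSeries S) (c : Sˣ) (α : Fin n × Fin n) (p q : Fin n) (j : ℤ), j < -N →
      (slice D e d c α p q).coeff j = 0 := by
  choose N hN using fun x : (Fin n × Fin n) × Fin n × Fin n =>
    exists_pole_bound (S := S) e (D x.1.1 x.1.2 x.2.1 x.2.2)
  refine ⟨Finset.univ.sup N, fun d c α p q j hj => hN ((p, q), α) c d j ?_⟩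
  have := Finset.le_sup (f := N) (Finset.mem_univ ((p, q), α))
  omega

end Core

/-! ### Trace differences of products, and specialisation to a single point. -/

section Contradiction

variable {S : Type u} [CommRing S] {n : ℕ}

/-- The difference of the constant terms of two traces. -/
def traceDiff (S : Type u) [CommRing S] (n : ℕ) :
    (Matrix (Fin n) (Fin n) (LaurentSeries S) × Matrix (Fin n) (Fin n) (LaurentSeries S))
      →ₗ[S] S where
  toFun v := v.1.trace.coeff 0 - v.2.trace.coeff 0
  map_add' v w := by
    simp only [Prod.fst_add, Prod.snd_add, Matrix.trace_add, HahnSeries.coeff_add]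
    ring
  map_smul' c v := by
    simp only [Prod.smul_fst, Prod.smul_snd, Matrix.trace_smul, HahnSeries.coeff_smul, smul_sub]
    rfl

/-- The pairs of matrices with poles of order at most `N`. -/
def boundedPoles (S : Type u) [CommRing S] (n N : ℕ) : Submodule S
    (Matrix (Fin n) (Fin n) (LaurentSeries S) × Matrix (Fin n) (Fin n) (LaurentSeries S)) where
  carrier := {v | ∀ p q, ∀ j : ℤ, j < -N → (v.1 p q).coeff j = 0 ∧ (v.2 p q).coeff j = 0}
  zero_mem' _ _ _ _ := ⟨rfl, rfl⟩
  add_mem' {v w} hv hw p q j hj := by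
    have h1 := hv p q j hj
    have h2 := hw p q j hj
    simp only [Prod.fst_add, Prod.snd_add, Matrix.add_apply, HahnSeries.coeff_add, h1.1, h1.2,
      h2.1, h2.2, add_zero, and_self]
  smul_mem' c v hv p q j hj := by
    have h1 := hv p q j hj
    simp only [Prod.smul_fst, Prod.smul_snd, Matrix.smul_apply, HahnSeries.coeff_smul, h1.1, h1.2,
      smul_zero, and_self]

/-- Consequences, for products of members of different families, of the multiplication rule
obtained from the Yang-Baxter equation. -/
theorem prod_mem_and_traceDiff_eq_zero [IsDomain S]
    (f : ℕ → Fin n × Fin n →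
      Matrix (Fin n) (Fin n) (LaurentSeries S) × Matrix (Fin n) (Fin n) (LaurentSeries S))
    (E : ℕ → ℕ → S) (P : ℕ → ℕ → Fin n → Fin n → Fin n → Fin n → S)
    (hE : ∀ i j, i < j → E i j ≠ 0)
    (hmul : ∀ i j, i < j → ∀ α β, E i j • (f j β * f i α) =
      ∑ o, P i j o α.2 β.1 β.2 • f i (α.1, o) - ∑ o, P i j α.1 α.2 β.1 o • f j (o, β.2))
    (htr : ∀ i α, traceDiff S n (f i α) = if α.1 = α.2 then 1 else 0)
    (N : ℕ) (hN : ∀ i α, f i α ∈ boundedPoles S n N) (α : Fin n × Fin n) (l : ℕ) :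
    ((List.range (l + 1)).reverse.map fun i => f i α).prod ∈ boundedPoles S n N ∧
      (0 < l → traceDiff S n ((List.range (l + 1)).reverse.map fun i => f i α).prod = 0) := by
  have hf : ∀ i j, i < j → ∀ α β, ∃ c : S, c ≠ 0 ∧
      c • (f j β * f i α) ∈ Submodule.span S (Set.range (f i) ∪ Set.range (f j)) := by
    intro i j hij α β
    refine ⟨E i j, hE i j hij, ?_⟩
    rw [hmul i j hij]
    refine sub_mem (sum_mem fun o _ => Submodule.smul_mem _ _ (Submodule.subset_span ?_))
      (sum_mem fun o _ => Submodule.smul_mem _ _ (Submodule.subset_span ?_))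
    · exact Or.inl ⟨_, rfl⟩
    · exact Or.inr ⟨_, rfl⟩
  -- The trace condition selects `o = α.1` in one sum and `o = β.2` in the other; both leave `P i j
  -- α.1 α.2 β.1 β.2`, and these cancel.
  have hpair : ∀ i j, i < j → ∀ α β, traceDiff S n (f j β * f i α) = 0 := by
    intro i j hij α β
    have h := congrArg (traceDiff S n) (hmul i j hij α β)
    simp only [map_smul, map_sub, map_sum, htr, smul_eq_mul, mul_ite, mul_one, mul_zero,
      Finset.sum_ite_eq, Finset.sum_ite_eq', Finset.mem_univ, if_true, sub_self] at h
    exact (mul_eq_zero.mp h).resolve_left (hE i j hij)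
  constructor
  · obtain ⟨c, hc, hmem⟩ := exists_smul_prod_mem_span f hf α l
    have hle : Submodule.span S (⋃ i ∈ Set.Iic l, Set.range (f i)) ≤ boundedPoles S n N := by
      rw [Submodule.span_le]
      refine Set.iUnion₂_subset fun i _ => ?_
      rintro _ ⟨β, rfl⟩
      exact hN i β
    intro p q j hj
    have h := hle hmem p q j hj
    simp only [Prod.smul_fst, Prod.smul_snd, Matrix.smul_apply, HahnSeries.coeff_smul,
      smul_eq_mul, mul_eq_zero, hc, false_or] at h
    exact h
  · intro hl
    obtain ⟨l, rfl⟩ : ∃ l', l = l' + 1 := ⟨l - 1, by omega⟩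
    obtain ⟨c, hc, hmem⟩ := exists_smul_prod_mem_span f hf α l
    -- All factors but the leftmost collapse, up to a nonzero scalar, into the span of single
    -- members, so the case of two factors suffices.
    have key : ∀ x ∈ Submodule.span S (⋃ i ∈ Set.Iic l, Set.range (f i)),
        traceDiff S n (f (l + 1) α * x) = 0 := by
      intro x hx
      induction hx using Submodule.span_induction with
      | mem x hx =>
        simp only [Set.mem_iUnion, Set.mem_Iic, Set.mem_range] at hx
        obtain ⟨i, hi, β, rfl⟩ := hx
        exact hpair i (l + 1) (by omega) β α
      | zero => rw [mul_zero, map_zero]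
      | add x y _ _ hx hy => rw [mul_add, map_add, hx, hy, add_zero]
      | smul s x _ hx => rw [mul_smul_comm, map_smul, hx, smul_zero]
    have h := key _ hmem
    rw [mul_smul_comm, map_smul, smul_eq_mul] at h
    rw [List.range_succ, List.reverse_append, List.reverse_singleton, List.singleton_append,
      List.map_cons, List.prod_cons]
    exact (mul_eq_zero.mp h).resolve_left hc

variable {k : Type u} [Field k]

theorem pow_eq_map_prod (φ : S →+* k) (f : ℕ → Matrix (Fin n) (Fin n) (LaurentSeries S))
    (hφ : ∀ i, (f i).map (laurentMap φ) = (f 0).map (laurentMap φ)) (L : List ℕ) :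
    ((f 0).map (laurentMap φ)) ^ L.length = (L.map f).prod.map (laurentMap φ) := by
  induction L with
  | nil => simp
  | cons i L ih =>
    rw [List.length_cons, pow_succ', ih, List.map_cons, List.prod_cons, Matrix.map_mul, hφ i]

/-- The family in `prod_mem_and_traceDiff_eq_zero` cannot specialise to a constant one. -/
theorem false_of_specialisation (φ : S →+* k)
    (f : ℕ → Matrix (Fin n) (Fin n) (LaurentSeries S) × Matrix (Fin n) (Fin n) (LaurentSeries S))
    (h1 : ∀ i, (f i).1.map (laurentMap φ) = (f 0).1.map (laurentMap φ))
    (h2 : ∀ i, (f i).2.map (laurentMap φ) = (f 0).2.map (laurentMap φ)) (N : ℕ)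
    (hN : ∀ l, ((List.range (l + 1)).reverse.map f).prod ∈ boundedPoles S n N)
    (htr : ∀ l, 0 < l → traceDiff S n ((List.range (l + 1)).reverse.map f).prod = 0)
    (htr1 : traceDiff S n (f 0) = 1) : False := by
  have hfst : ∀ L : List ℕ, (L.map f).prod.1 = (L.map fun i => (f i).1).prod := by
    intro L
    induction L with
    | nil => rfl
    | cons i L ih => simp only [List.map_cons, List.prod_cons, Prod.fst_mul, ih]
  have hsnd : ∀ L : List ℕ, (L.map f).prod.2 = (L.map fun i => (f i).2).prod := by
    intro L
    induction L with
    | nil => rfl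
    | cons i L ih => simp only [List.map_cons, List.prod_cons, Prod.snd_mul, ih]
  -- Under `φ` all factors coincide, and the products over distinct points become powers of one
  -- matrix.
  have hpow : ∀ l : ℕ, ((f 0).1.map (laurentMap φ)) ^ (l + 1) =
        ((List.range (l + 1)).reverse.map f).prod.1.map (laurentMap φ) ∧
      ((f 0).2.map (laurentMap φ)) ^ (l + 1) =
        ((List.range (l + 1)).reverse.map f).prod.2.map (laurentMap φ) := by
    intro l
    have e1 := pow_eq_map_prod φ (fun i => (f i).1) h1 (List.range (l + 1)).reverse
    have e2 := pow_eq_map_prod φ (fun i => (f i).2) h2 (List.range (l + 1)).reverse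
    rw [List.length_reverse, List.length_range] at e1 e2
    exact ⟨e1.trans (by rw [hfst]), e2.trans (by rw [hsnd])⟩
  -- The lattice argument also needs the bound for the zeroth power, which is not among the
  -- products.
  have hone : ∀ p q, ∀ j : ℤ, j < -N →
      ((1 : Matrix (Fin n) (Fin n) (LaurentSeries k)) p q).coeff j = 0 := by
    intro p q j hj
    rw [Matrix.one_apply]
    split_ifs
    · rw [HahnSeries.coeff_one, if_neg (by omega)]
    · rfl
  obtain ⟨_, M, hM⟩ := exists_matrix_trace_pow_eq ((f 0).1.map (laurentMap φ)) N (by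
    intro l p q j hj
    cases l with
    | zero => rw [pow_zero]; exact hone p q j hj
    | succ l =>
      rw [(hpow l).1, Matrix.map_apply, laurentMap_coeff, (hN l p q j hj).1, map_zero])
  obtain ⟨_, M', hM'⟩ := exists_matrix_trace_pow_eq ((f 0).2.map (laurentMap φ)) N (by
    intro l p q j hj
    cases l with
    | zero => rw [pow_zero]; exact hone p q j hj
    | succ l =>
      rw [(hpow l).2, Matrix.map_apply, laurentMap_coeff, (hN l p q j hj).2, map_zero])
  have htrace : ∀ A : Matrix (Fin n) (Fin n) (LaurentSeries S),
      ((A.map (laurentMap φ)).trace).coeff 0 = φ (A.trace.coeff 0) := by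
    intro A
    rw [← laurentMap_coeff, AddMonoidHom.map_trace]
  have hdiff : ∀ l, (M ^ (l + 1)).trace - (M' ^ (l + 1)).trace =
      φ (traceDiff S n ((List.range (l + 1)).reverse.map f).prod) := by
    intro l
    rw [← hM, ← hM', (hpow l).1, (hpow l).2, htrace, htrace, ← map_sub]
    rfl
  -- Products of at least two factors have trace difference zero; this forces `M` and `M'` to have
  -- the same trace, against the value `1` for a single factor.
  have h := trace_eq_of_trace_pow_eq M M' fun l hl => by
    obtain ⟨l, rfl⟩ : ∃ l', l = l' + 1 := ⟨l - 1, by omega⟩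
    rw [← sub_eq_zero, hdiff, htr l (by omega), map_zero]
  have h0 := hdiff 0
  simp only [zero_add, pow_one, h, sub_self, List.range_one, List.reverse_singleton, List.map_cons,
    List.map_nil, List.prod_singleton, htr1, map_one] at h0
  exact zero_ne_one h0

end Contradiction

/-! ### The points `1 + i X` and the nonexistence theorem. -/

section Nonexistence

variable {k : Type u} [Field k] {n : ℕ}

/-- The unit `1 + i X` of `k⟦X⟧`. -/
def linUnit (k : Type u) [Field k] (i : ℕ) : (PowerSeries k)ˣ :=
  (PowerSeries.isUnit_iff_constantCoeff.mpr
    (by simp : IsUnit (PowerSeries.constantCoeff (1 + (i : k) • PowerSeries.X : PowerSeries k)))).unit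

theorem val_linUnit (i : ℕ) :
    (linUnit k i : PowerSeries k) = 1 + (i : k) • PowerSeries.X := rfl

theorem constantCoeff_linUnit (i : ℕ) :
    PowerSeries.constantCoeff (linUnit k i : PowerSeries k) = 1 := by
  simp [val_linUnit]

theorem coeff_one_linUnit_pow (i m : ℕ) :
    PowerSeries.coeff 1 ((linUnit k i : PowerSeries k) ^ m) = m * i := by
  induction m with
  | zero => simp
  | succ m ih =>
    rw [pow_succ, PowerSeries.coeff_mul, Finset.Nat.antidiagonal_succ]
    simp [ih, constantCoeff_linUnit]
    simp [val_linUnit]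
    ring

/-- The linear coefficient of `(1 + i X)^m` is `m i`, so in characteristic zero the `m`-th powers of
these points are pairwise distinct, although all the points reduce to `1` at `X = 0`. -/
theorem ev_delta_linUnit_ne_zero [CharZero k] (m : ℕ) (hm : 0 < m) (i j : ℕ) (hij : i < j) :
    Laurent.ev ![linUnit k i, linUnit k j] (delta m : Laurent k (Fin 2)) ≠ 0 := by
  intro h
  rw [delta, map_sub, map_one, Laurent.ev_single, one_smul, Fin.prod_univ_two, sub_eq_zero] at h
  have h1 : linUnit k i ^ (m : ℤ) * linUnit k j ^ (-m : ℤ) = 1 := Units.ext h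
  rw [zpow_neg, mul_inv_eq_one, zpow_natCast, zpow_natCast] at h1
  have h2 := congrArg (fun u : (PowerSeries k)ˣ => PowerSeries.coeff 1 (u : PowerSeries k)) h1
  simp only [Units.val_pow_eq_pow_val, coeff_one_linUnit_pow] at h2
  have hm' : (m : k) ≠ 0 := Nat.cast_ne_zero.mpr hm.ne'
  exact hij.ne (Nat.cast_injective (mul_left_cancel₀ hm' h2))

theorem not_laurentCYBE [CharZero k] (hn : 0 < n) (m : ℕ) (hm : 0 < m)
    (g : ℕ → Fin n → Fin n → Fin n → Fin n → k)
    (htr : ∀ j < m, ∀ a b, ∑ p, g j p p a b = if j = 0 ∧ a = b then 1 else 0)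
    (t : Fin n → Fin n → Fin n → Fin n → Laurent k (Fin 2)) :
    ¬ LaurentCYBE m (fun p q a b => numerator m (fun j => g j p q a b) (t p q a b)) := by
  intro hD
  choose d hd hd0 using fun i => exists_inverse_delta_infty (k := k) m hm (linUnit k i)
  choose d' hd' hd0' using fun i => exists_inverse_delta_zero (k := k) m hm (linUnit k i)
  set D : Fin n → Fin n → Fin n → Fin n → Laurent k (Fin 2) :=
    fun p q a b => numerator m (fun j => g j p q a b) (t p q a b) with hDdef
  let f : ℕ → Fin n × Fin n → Matrix (Fin n) (Fin n) (LaurentSeries (PowerSeries k)) ×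
      Matrix (Fin n) (Fin n) (LaurentSeries (PowerSeries k)) := fun i α =>
    (slice D (-1) (d i) (linUnit k i) α, slice D 1 (d' i) (linUnit k i) α)
  have hmul : ∀ i j, i < j → ∀ α β,
      Laurent.ev ![linUnit k i, linUnit k j] (delta m : Laurent k (Fin 2)) • (f j β * f i α) =
      ∑ o, Laurent.ev ![linUnit k i, linUnit k j] (D o α.2 β.1 β.2) • f i (α.1, o) -
      ∑ o, Laurent.ev ![linUnit k i, linUnit k j] (D α.1 α.2 β.1 o) • f j (o, β.2) := by
    intro i j _ α β
    refine Prod.ext ?_ ?_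
    · rw [Prod.fst_sub, Prod.fst_sum, Prod.fst_sum]
      exact slice_mul_slice hD (-1) (d i) (d j) (linUnit k i) (linUnit k j) (hd i) (hd j) α β
    · rw [Prod.snd_sub, Prod.snd_sum, Prod.snd_sum]
      exact slice_mul_slice hD 1 (d' i) (d' j) (linUnit k i) (linUnit k j) (hd' i) (hd' j) α β
  have htrf : ∀ i α, traceDiff (PowerSeries k) n (f i α) = if α.1 = α.2 then 1 else 0 := by
    intro i α
    change (slice D (-1) (d i) (linUnit k i) α).trace.coeff 0 -
      (slice D 1 (d' i) (linUnit k i) α).trace.coeff 0 = _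
    rw [hDdef, coeff_zero_trace_slice hm htr (-1) (d i) (linUnit k i) (hd i) α,
      coeff_zero_trace_slice hm htr 1 (d' i) (linUnit k i) (hd' i) α,
      coeff_zero_ev_param (-1) (by norm_num), hd0, hd0']
    split_ifs <;> ring
  obtain ⟨N, hN⟩ := exists_slice_pole_bound (S := PowerSeries k) D (-1)
  obtain ⟨N', hN'⟩ := exists_slice_pole_bound (S := PowerSeries k) D 1
  have hbd : ∀ i α, f i α ∈ boundedPoles (PowerSeries k) n (max N N') := fun i α p q j hj =>
    ⟨hN _ _ _ _ _ _ (by omega), hN' _ _ _ _ _ _ (by omega)⟩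
  -- The index `(0,0)`, available because `n > 0`, is diagonal, so its slices have trace difference
  -- `1`.
  have hprod := prod_mem_and_traceDiff_eq_zero f
    (fun i j => Laurent.ev ![linUnit k i, linUnit k j] (delta m : Laurent k (Fin 2)))
    (fun i j p q a b => Laurent.ev ![linUnit k i, linUnit k j] (D p q a b))
    (ev_delta_linUnit_ne_zero m hm) hmul htrf _ hbd (⟨0, hn⟩, ⟨0, hn⟩)
  -- Setting `X = 0` merges all the points `1 + i X` into the point `1`.
  let φ : PowerSeries k →ₐ[k] k :=
    { (PowerSeries.constantCoeff : PowerSeries k →+* k) with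
      commutes' := fun c => PowerSeries.constantCoeff_C c }
  have hφ : ∀ i, Units.map (φ : PowerSeries k →* k) (linUnit k i) =
      Units.map (φ : PowerSeries k →* k) (linUnit k 0) := fun i =>
    Units.ext ((constantCoeff_linUnit i).trans (constantCoeff_linUnit 0).symm)
  exact false_of_specialisation φ.toRingHom (fun i => f i (⟨0, hn⟩, ⟨0, hn⟩))
    (fun i => laurentMap_slice φ (-1) _ _ _ _ (hd i) (hd 0) (hφ i) _)
    (fun i => laurentMap_slice φ 1 _ _ _ _ (hd' i) (hd' 0) (hφ i) _) _
    (fun l => (hprod l).1) (fun l => (hprod l).2) ((htrf 0 _).trans (if_pos rfl))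

end Nonexistence

end ACYBE

end

theorem mainTheorem8 (k : Type*) [Field k] [IsAlgClosed k] [CharZero k] (n : ℕ) (hn : 0 < n) :
    ¬ ∃ r : ACYBE.Tensor2 k (Matrix (Fin n) (Fin n) k),
      ACYBE.CYB r = 0 ∧
        (ACYBE.IsTrigonometric (ACYBE.casimir k n) r ∨
          ACYBE.IsQuasiTrigonometric (ACYBE.casimir k n) r) := by
  rintro ⟨r, hr, ⟨m, σ, ε, γs, t, hm, -, hε, hsum, hσ, h⟩ | ⟨t, h⟩⟩
  · obtain ⟨t', ht'⟩ := ACYBE.exists_laurentCYBE_of_trigForm m hm σ ε γs t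
      (ACYBE.CYB_eq_zero_of_equivalent h hr)
    exact ACYBE.not_laurentCYBE hn m hm _ (fun j hj a b => ACYBE.sum_entry2_graded
      (Nat.cast_ne_zero.mpr hn.ne') m σ ε γs hm hε hsum hσ j hj a b) t' ht'
  · obtain ⟨t', ht'⟩ := ACYBE.exists_laurentCYBE_of_quasiTrigForm _ t
      (ACYBE.CYB_eq_zero_of_equivalent h hr)
    refine ACYBE.not_laurentCYBE hn 1 Nat.one_pos _ (fun j hj a b => ?_) t' ht'
    rw [ACYBE.sum_entry2, ACYBE.traceEntry_casimir]
    simp [Nat.lt_one_iff.mp hj]
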